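/- **Setting.** Let $d\ge 2$, $n\ge 3$, $r\in\mathbb{R}^n$ and $\varrho\in\mathbb{R}^n$ with all $r_i>0$ and $\varrho_i>0$, and assume $r_j<\frac12\sum_{i=1}^n r_i$ for every $j$. Let $\mathbb{B}=\{w\in\mathbb{R}^d:|w|<1\}$ and $\mathbb{S}=\{x\in\mathbb{R}^d:|x|=1\}$. Let $\mathrm{Arm}^\times\subset(\mathbb{R}^d)^n$ be the set of $n$-tuples $x=(x_1,\dots,x_n)$ of pairwise distinct points of $\mathbb{S}$, and let $\mathrm{Pol}^\times=\{y\in\mathrm{Arm}^\times:\sum_i r_iy_i=0\}$. Equip $(\mathbb{R}^d)^n$ with the inner product $\langle u,v\rangle_\varrho=\sum_i\varrho_i^2\langle u_i,v_i\rangle$, $\mathbb{R}^d$ with the standard one, and $\mathbb{R}^d\times(\mathbb{R}^d)^n$ with their product; $\mathrm{Arm}^\times$ and $\mathbb{B}\times\mathrm{Pol}^\times$ carry the restrictions of these metrics. Put $$\sigma(w,z)=\frac{(1-|w|^2)\,z-(1+|z|^2-2\langle w,z\rangle)\,w}{1-2\langle w,z\rangle+|w|^2|z|^2},$$ and let the conformal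 opening map be $\mathrm{op}(w,y)=(\sigma(-w,y_1),\dots,\sigma(-w,y_n))$. Its Jacobian is $J\mathrm{op}(w,y)=\sqrt{\det(D\mathrm{op}(w,y)^*\,D\mathrm{op}(w,y))}$, where $D\mathrm{op}(w,y)$ is the differential on $T_{(w,y)}(\mathbb{B}\times\mathrm{Pol}^\times)$ and the adjoint is taken with respect to the metrics above. Regard $\mathbb{B}$ as the Poincaré ball model of hyperbolic space. For $w\in\mathbb{B}$ and $x\in\mathbb{S}$, the director $V_x(w)$ is the (hyperbolic) unit tangent vector at $w$ of the geodesic ray from $w$ to the ideal point $x$. A point $w\in\mathbb{B}$ is a conformal barycenter of $x\in\mathrm{Arm}^\times$ if $\sum_i r_iV_{x_i}(w)=0$. **Theorem 3.1.** 1. For all $(w,y)\in\mathbb{B}\times\mathrm{Pol}^\times$, $$J\mathrm{op}(w,y)=\Big(\frac{2}{1-|w|^2}\Big)^{d}\,\frac{\det\big(\sum_{i=1}^n r_i\,(I_d-y_iy_i^{T})\big)}{\sqrt{\det\big(\sum_{i=1}^n (r_i^2/\varrho_i^2)\,(I_d-y_iy_i^{T})\big)}}\,\Big(\prod_{i=1}^n\frac{1-|w|^2}{|w+y_i|^2}\Big)^{d-1}\neq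 0.$$ 2. $\mathbb{B}\times\mathrm{Pol}^\times$ and $\mathrm{Arm}^\times$ are smooth embedded submanifolds of $\mathbb{R}^d\times(\mathbb{R}^d)^n$ and $(\mathbb{R}^d)^n$, both of dimension $n(d-1)$. Every $x\in\mathrm{Arm}^\times$ has exactly one conformal barycenter $w_*(x)$. The map $\mathrm{op}$ is a diffeomorphism of $\mathbb{B}\times\mathrm{Pol}^\times$ onto $\mathrm{Arm}^\times$, and its inverse is the conformal closure map $\mathrm{cl}(x)=\big(w_*(x),(\sigma(w_*(x),x_1),\dots,\sigma(w_*(x),x_n))\big)$, which is therefore a diffeomorphism of $\mathrm{Arm}^\times$ onto $\mathbb{B}\times\mathrm{Pol}^\times$. 3. For fixed $d$, $J\mathrm{op}(w,y)$ can be computed in $O(n)$ time and memory: for every $d\ge2$ there are a single program of a real random access machine (exact real arithmetic $+,-,\times,/,\sqrt{\ }$ and comparisons, rational constants, indirectly addressed real memory and bounded loops, each elementary operation costing one step) and a constant $C$ such that for all $n\ge3$ and all $r,\varrho,w,y$ as above, the program, started with $(n,r,\varrho,w,y)$ in its memory, outputs $J\mathrm{op}(w,y)$ after at most $Cn$ steps,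 accessing only the first $Cn$ cells of its memory. -/

import Mathlib

open scoped ContDiff

noncomputable section

namespace ConformalPolygon

/-! ### Smooth maps, submanifolds, tangent spaces and Jacobians in normed spaces -/

section Smooth

variable {E F : Type*} [NormedAddCommGroup E] [NormedSpace ℝ E]
  [NormedAddCommGroup F] [NormedSpace ℝ F]

/-- Smoothness of a map on an arbitrary subset `S` of a normed space: near every point of `S`
the map is the restriction of a smooth map defined on an open set of the ambient space. -/
def SmoothOnSubset (f : E → F) (S : Set E) : Prop :=
  ∀ p ∈ S, ∃ U : Set E, IsOpen U ∧ p ∈ U ∧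
    ∃ g : E → F, ContDiffOn ℝ ∞ g U ∧ Set.EqOn g f (S ∩ U)

/-- `f` restricts to a diffeomorphism of `S` onto `T`, and `g` restricts to its inverse. -/
structure IsDiffeomorphismWithInverse (f : E → F) (g : F → E) (S : Set E) (T : Set F) : Prop where
  mapsTo : Set.MapsTo f S T
  mapsTo_inv : Set.MapsTo g T S
  leftInv : ∀ p ∈ S, g (f p) = p
  rightInv : ∀ q ∈ T, f (g q) = q
  smooth : SmoothOnSubset f S
  smooth_inv : SmoothOnSubset g T

/-- `M` is a smooth embedded submanifold of dimension `k`: locally it is the zero set of a smooth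
submersion onto `ℝᵐ`, where `k + m` is the dimension of the ambient space. -/
def IsSmoothSubmanifold (M : Set E) (k : ℕ) : Prop :=
  ∃ m : ℕ, k + m = Module.finrank ℝ E ∧ ∀ p ∈ M, ∃ U : Set E, IsOpen U ∧ p ∈ U ∧
    ∃ Φ : E → EuclideanSpace ℝ (Fin m), ContDiffOn ℝ ∞ Φ U ∧
      M ∩ U = {q ∈ U | Φ q = 0} ∧ ∀ q ∈ M ∩ U, Function.Surjective (fderiv ℝ Φ q)

/-- The tangent space of `M` at `p`, spanned by the velocities of smooth curves in `M`
through `p`. -/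
def tangentSpaceAt (M : Set E) (p : E) : Submodule ℝ E :=
  Submodule.span ℝ {v | ∃ γ : ℝ → E, ∃ ε : ℝ, 0 < ε ∧ ContDiffOn ℝ ∞ γ (Set.Ioo (-ε) ε) ∧
    (∀ t ∈ Set.Ioo (-ε) ε, γ t ∈ M) ∧ γ 0 = p ∧ deriv γ 0 = v}

/-- The differential at `p` of `f` restricted to `M`, as a linear map on the tangent space. -/
def differentialAlong (f : E → F) (M : Set E) (p : E) : tangentSpaceAt M p →ₗ[ℝ] F :=
  (fderivWithin ℝ f M p : E →ₗ[ℝ] F) ∘ₗ (tangentSpaceAt M p).subtype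

end Smooth

section Adjoint

variable {T W : Type*} [AddCommGroup T] [Module ℝ T] [AddCommGroup W] [Module ℝ W]

/-- Restrictions of positive definite forms to subspaces are nondegenerate. -/
theorem restrict_nondegenerate (g : LinearMap.BilinForm ℝ T) (hg : ∀ v, v ≠ 0 → 0 < g v v)
    (V : Submodule ℝ T) : (g.restrict V).Nondegenerate := by
  constructor
  · intro x hx
    by_contra hne
    have h1 : (x : T) ≠ 0 := fun h => hne (Subtype.ext h)
    exact (hg x h1).ne' (hx x)
  · intro x hx
    by_contra hne
    have h1 : (x : T) ≠ 0 := fun h => hne (Subtype.ext h)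
    exact (hg x h1).ne' (hx x)

/-- The adjoint of `L : (T, g) → (W, h)`, characterised by `g (L* u) v = h u (L v)`. -/
def metricAdjoint [FiniteDimensional ℝ T] (g : LinearMap.BilinForm ℝ T) (hg : g.Nondegenerate)
    (h : LinearMap.BilinForm ℝ W) (L : T →ₗ[ℝ] W) : W →ₗ[ℝ] T :=
  (LinearMap.BilinForm.toDual g hg).symm.toLinearMap ∘ₗ L.dualMap ∘ₗ h

theorem metricAdjoint_spec [FiniteDimensional ℝ T] (g : LinearMap.BilinForm ℝ T)
    (hg : g.Nondegenerate) (h : LinearMap.BilinForm ℝ W) (L : T →ₗ[ℝ] W) (u : W) (v : T) :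
    g (metricAdjoint g hg h L u) v = h u (L v) := by
  simp [metricAdjoint]

end Adjoint

/-- The Jacobian determinant `√(det (Df* Df))` at `p` of `f` restricted to the submanifold `M`.
Domain and codomain carry the restrictions of the inner products `g` and `h` of the ambient spaces,
so it does not matter whether `Df` is regarded as a map into the ambient space or into the tangent
space of a submanifold that contains the image of `M`. -/
def jacobianAlong {E F : Type*} [NormedAddCommGroup E] [NormedSpace ℝ E] [FiniteDimensional ℝ E]
    [NormedAddCommGroup F] [NormedSpace ℝ F]
    (g : LinearMap.BilinForm ℝ E) (hg : ∀ v, v ≠ 0 → 0 < g v v) (h : LinearMap.BilinForm ℝ F)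
    (f : E → F) (M : Set E) (p : E) : ℝ :=
  let D := differentialAlong f M p
  let Dadj := metricAdjoint (g.restrict (tangentSpaceAt M p))
    (restrict_nondegenerate g hg (tangentSpaceAt M p)) h D
  Real.sqrt (LinearMap.det (Dadj ∘ₗ D))

/-! ### Polygon spaces and their metrics -/

variable {d n : ℕ}

/-- `ℝᵈ` with its Euclidean norm. -/
abbrev Vec (d : ℕ) : Type := EuclideanSpace ℝ (Fin d)

/-- The open unit ball of `ℝᵈ`. -/
def unitBall (d : ℕ) : Set (Vec d) := Metric.ball 0 1

/-- `n`-tuples of unit vectors: the directions of the edges of an open polygon. -/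
def Arm (d n : ℕ) : Set (Fin n → Vec d) := {x | ∀ i, ‖x i‖ = 1}

/-- Directions of closed polygons with edge lengths `r`. -/
def Pol (d : ℕ) {n : ℕ} (r : Fin n → ℝ) : Set (Fin n → Vec d) :=
  {y | y ∈ Arm d n ∧ ∑ i, r i • y i = 0}

/-- Open polygons with pairwise distinct edge directions. -/
def ArmX (d n : ℕ) : Set (Fin n → Vec d) :=
  {x | x ∈ Arm d n ∧ ∀ i j, i ≠ j → x i ≠ x j}

/-- Closed polygons with pairwise distinct edge directions. -/
def PolX (d : ℕ) {n : ℕ} (r : Fin n → ℝ) : Set (Fin n → Vec d) := Pol d r ∩ ArmX d n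

/-- The inner product `∑ ϱᵢ² ⟨uᵢ, vᵢ⟩` on `(ℝᵈ)ⁿ`. -/
def armMetric (d : ℕ) {n : ℕ} (ϱ : Fin n → ℝ) : LinearMap.BilinForm ℝ (Fin n → Vec d) :=
  LinearMap.mk₂ ℝ (fun u v => ∑ i, ϱ i ^ 2 * inner ℝ (u i) (v i))
    (fun u u' v => by simp [inner_add_left, mul_add, Finset.sum_add_distrib])
    (fun c u v => by
      simp only [Pi.smul_apply, real_inner_smul_left, smul_eq_mul, Finset.mul_sum]
      exact Finset.sum_congr rfl fun i _ => by ring)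
    (fun u v v' => by simp [inner_add_right, mul_add, Finset.sum_add_distrib])
    (fun c u v => by
      simp only [Pi.smul_apply, real_inner_smul_right, smul_eq_mul, Finset.mul_sum]
      exact Finset.sum_congr rfl fun i _ => by ring)

/-- The product of the Euclidean inner product on `ℝᵈ` and of `armMetric` on `(ℝᵈ)ⁿ`. -/
def ballPolMetric (d : ℕ) {n : ℕ} (ϱ : Fin n → ℝ) :
    LinearMap.BilinForm ℝ (Vec d × (Fin n → Vec d)) :=
  LinearMap.mk₂ ℝ (fun u v => inner ℝ u.1 v.1 + armMetric d ϱ u.2 v.2)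
    (fun u u' v => by
      simp only [Prod.fst_add, Prod.snd_add, inner_add_left, map_add, LinearMap.add_apply]
      ring)
    (fun c u v => by
      simp only [Prod.smul_fst, Prod.smul_snd, real_inner_smul_left, map_smul,
        LinearMap.smul_apply, smul_eq_mul]
      ring)
    (fun u v v' => by
      simp only [Prod.fst_add, Prod.snd_add, inner_add_right, map_add]
      ring)
    (fun c u v => by
      simp only [Prod.smul_fst, Prod.smul_snd, real_inner_smul_right, map_smul, smul_eq_mul]
      ring)

theorem ballPolMetric_pos (d : ℕ) {n : ℕ} (ϱ : Fin n → ℝ) (hϱ : ∀ i, 0 < ϱ i)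
    (v : Vec d × (Fin n → Vec d)) (hv : v ≠ 0) : 0 < ballPolMetric d ϱ v v := by
  have key : ballPolMetric d ϱ v v = ‖v.1‖ ^ 2 + ∑ i, ϱ i ^ 2 * ‖v.2 i‖ ^ 2 := by
    simp [ballPolMetric, armMetric]
  have hs : 0 ≤ ∑ i, ϱ i ^ 2 * ‖v.2 i‖ ^ 2 := Finset.sum_nonneg fun i _ => by positivity
  rw [key]
  by_contra hle
  have h1 : ‖v.1‖ ^ 2 = 0 := by nlinarith [sq_nonneg ‖v.1‖]
  have h2 : ∑ i, ϱ i ^ 2 * ‖v.2 i‖ ^ 2 = 0 := by nlinarith [sq_nonneg ‖v.1‖]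
  rw [Finset.sum_eq_zero_iff_of_nonneg (fun i _ => by positivity)] at h2
  apply hv
  refine Prod.ext (by simpa using h1) (funext fun i => ?_)
  have h3 := h2 i (Finset.mem_univ i)
  have h4 := (hϱ i).ne'
  simpa [h4] using h3

/-! ### The shift map, the opening map, the conformal barycenter and the closure map -/

/-- The shift map `σ(w, z)`: the hyperbolic translation that moves `w` to `0`. -/
def shift (w z : Vec d) : Vec d :=
  (1 - 2 * inner ℝ w z + ‖w‖ ^ 2 * ‖z‖ ^ 2)⁻¹ •
    ((1 - ‖w‖ ^ 2) • z - (1 + ‖z‖ ^ 2 - 2 * inner ℝ w z) • w)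

/-- The conformal opening map `(w, y) ↦ (σ(-w, yᵢ))ᵢ`. -/
def opening (p : Vec d × (Fin n → Vec d)) : Fin n → Vec d := fun i => shift (-p.1) (p.2 i)

/-- The Jacobian determinant of the opening map on `𝔹 × Pol^×`. -/
def Jop (r ϱ : Fin n → ℝ) (hϱ : ∀ i, 0 < ϱ i) (w : Vec d) (y : Fin n → Vec d) : ℝ :=
  jacobianAlong (ballPolMetric d ϱ) (ballPolMetric_pos d ϱ hϱ) (armMetric d ϱ)
    opening (unitBall d ×ˢ PolX d r) (w, y)

/-- The hyperbolic distance in the Poincaré ball model (curvature `-1`). -/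
def hypDist (u v : Vec d) : ℝ :=
  Real.arcosh (1 + 2 * ‖u - v‖ ^ 2 / ((1 - ‖u‖ ^ 2) * (1 - ‖v‖ ^ 2)))

/-- `γ`, restricted to `[0, ∞)`, is the unit speed hyperbolic geodesic ray from the point `w` of
the ball to the point `x` of the sphere at infinity. -/
structure IsGeodesicRay (w x : Vec d) (γ : ℝ → Vec d) : Prop where
  mem_ball : ∀ t, 0 ≤ t → γ t ∈ unitBall d
  isometry : ∀ s t, 0 ≤ s → 0 ≤ t → hypDist (γ s) (γ t) = |s - t|
  start : γ 0 = w
  limit : Filter.Tendsto γ Filter.atTop (nhds x)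

/-- `v` is the director at `w` towards `x`: the (hyperbolic) unit tangent vector at `w` to the
geodesic ray joining `w` to `x`. -/
def IsDirector (w x v : Vec d) : Prop :=
  ∃ γ : ℝ → Vec d, IsGeodesicRay w x γ ∧ HasDerivWithinAt γ v (Set.Ici 0) 0

/-- `w` is a conformal barycenter of `x` with weights `r`. -/
def IsConformalBarycenter (r : Fin n → ℝ) (x : Fin n → Vec d) (w : Vec d) : Prop :=
  w ∈ unitBall d ∧ ∃ V : Fin n → Vec d, (∀ i, IsDirector w (x i) (V i)) ∧ ∑ i, r i • V i = 0

open Classical in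
/-- The conformal barycenter `w_*(x)` (the value `0` is used if there is none). -/
def conformalBarycenter (r : Fin n → ℝ) (x : Fin n → Vec d) : Vec d :=
  if h : ∃ w, IsConformalBarycenter r x w then h.choose else 0

/-- The conformal closure map `x ↦ (w_*(x), (σ(w_*(x), xᵢ))ᵢ)`. -/
def closureMap (r : Fin n → ℝ) (x : Fin n → Vec d) : Vec d × (Fin n → Vec d) :=
  (conformalBarycenter r x, fun i => shift (conformalBarycenter r x) (x i))

/-- The matrix `∑ cᵢ (I - yᵢ yᵢᵀ)`. -/
def projSum (c : Fin n → ℝ) (y : Fin n → Vec d) : Matrix (Fin d) (Fin d) ℝ :=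
  ∑ i, c i • (1 - Matrix.of fun a b => y i a * y i b)

/-! ### A real random access machine with step and memory counts -/

namespace RealRAM

/-- Programs of a real random access machine.  The machine has real registers `x₀, x₁, …`, index
registers `p₀, p₁, …` with values in `ℕ`, and an array of real memory cells `m[0], m[1], …` that is
addressed through the index registers.  Any given program mentions only finitely many registers. -/
inductive Prog : Type
  /-- do nothing -/
  | skip : Prog
  /-- `x_a := q` -/
  | const (a : ℕ) (q : ℚ) : Prog
  /-- `x_a := x_b + x_c` -/
  | add (a b c : ℕ) : Prog
  /-- `x_a := x_b - x_c` -/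
  | sub (a b c : ℕ) : Prog
  /-- `x_a := x_b * x_c` -/
  | mul (a b c : ℕ) : Prog
  /-- `x_a := x_b / x_c` -/
  | div (a b c : ℕ) : Prog
  /-- `x_a := √ x_b` -/
  | sqrt (a b : ℕ) : Prog
  /-- `x_a := m[p_i]` -/
  | load (a i : ℕ) : Prog
  /-- `m[p_i] := x_a` -/
  | store (i a : ℕ) : Prog
  /-- `p_i := k` -/
  | idxConst (i k : ℕ) : Prog
  /-- `p_i := p_j + p_k` -/
  | idxAdd (i j k : ℕ) : Prog
  /-- first `P`, then `Q` -/
  | seq (P Q : Prog) : Prog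
  /-- if `x_a < x_b` then `P` else `Q` -/
  | ifLt (a b : ℕ) (P Q : Prog) : Prog
  /-- repeat `P` as often as the value of `p_i` on entry says -/
  | loop (i : ℕ) (P : Prog) : Prog

/-- Machine states.  `steps` is the number of steps executed so far, and `space` is the least `N`
such that only the memory cells `m[0], …, m[N-1]` have been accessed so far. -/
structure State : Type where
  real : ℕ → ℝ
  idx : ℕ → ℕ
  mem : ℕ → ℝ
  steps : ℕ
  space : ℕ

namespace State

/-- Count one step. -/
def tick (s : State) : State := { s with steps := s.steps + 1 }

/-- Assign a real register, in one step. -/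
def setReal (s : State) (a : ℕ) (v : ℝ) : State :=
  { s with real := Function.update s.real a v, steps := s.steps + 1 }

/-- Assign an index register, in one step. -/
def setIdx (s : State) (i k : ℕ) : State :=
  { s with idx := Function.update s.idx i k, steps := s.steps + 1 }

/-- Record an access to the memory cell with address `k`. -/
def touch (s : State) (k : ℕ) : State := { s with space := max s.space (k + 1) }

/-- Write a memory cell, in one step. -/
def setMem (s : State) (k : ℕ) (v : ℝ) : State :=
  { s with mem := Function.update s.mem k v, steps := s.steps + 1 }

end State

/-- The effect of running a program.  Every elementary instruction takes one step, and so do every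
comparison, every entry into a loop and every iteration of a loop (in addition to its body). -/
def run : Prog → State → State
  | .skip, s => s
  | .const a q, s => s.setReal a q
  | .add a b c, s => s.setReal a (s.real b + s.real c)
  | .sub a b c, s => s.setReal a (s.real b - s.real c)
  | .mul a b c, s => s.setReal a (s.real b * s.real c)
  | .div a b c, s => s.setReal a (s.real b / s.real c)
  | .sqrt a b, s => s.setReal a (Real.sqrt (s.real b))
  | .load a i, s => (s.setReal a (s.mem (s.idx i))).touch (s.idx i)
  | .store i a, s => (s.setMem (s.idx i) (s.real a)).touch (s.idx i)
  | .idxConst i k, s => s.setIdx i k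
  | .idxAdd i j k, s => s.setIdx i (s.idx j + s.idx k)
  | .seq P Q, s => run Q (run P s)
  | .ifLt a b P Q, s => if s.real a < s.real b then run P s.tick else run Q s.tick
  | .loop i P, s => (fun t => run P t.tick)^[s.idx i] s.tick

end RealRAM

/-- A fresh machine state that holds the input `(n, r, ϱ, w, y)`: the number `n` is in the index
register `p₀`, the coordinates of `w` are in the cells `m[0], …, m[d-1]`, and the `n` records
`(rᵢ, ϱᵢ, yᵢ)` of length `d + 2` follow one after the other.  All other registers and cells may
have arbitrary contents. -/
structure HoldsInput (r ϱ : Fin n → ℝ) (w : Vec d) (y : Fin n → Vec d)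
    (s : RealRAM.State) : Prop where
  steps : s.steps = 0
  space : s.space = 0
  size : s.idx 0 = n
  mem_w : ∀ k : Fin d, s.mem k = w k
  mem_r : ∀ i : Fin n, s.mem (d + i * (d + 2)) = r i
  mem_ϱ : ∀ i : Fin n, s.mem (d + i * (d + 2) + 1) = ϱ i
  mem_y : ∀ (i : Fin n) (k : Fin d), s.mem (d + i * (d + 2) + 2 + k) = y i k

end ConformalPolygon

end

/-! For fixed `w` in the ball the maps σ(w,·) and σ(-w,·) are mutually inverse on the closed ball.
So `opening` is inverted by x ↦ (w, σ(w,x₁), …, σ(w,xₙ)) once each x determines exactly one w with ∑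
rᵢ σ(w,xᵢ) = 0. This is the barycenter equation: translating `w` to the origin turns geodesic rays
into t ↦ tanh(t/2) z, whence V_x(w) = ((1-|w|²)/2) σ(w,x) (`isDirector_iff`).

Existence: the potential ∑ rᵢ log(|xᵢ-w|²/(1-|w|²)) vanishes at 0 and is positive near the sphere
because no rⱼ reaches half of the total, so it has an interior minimum, where the gradient gives the
equation (`exists_barycenter`). Uniqueness: two solutions would make a sum of nonnegative terms
vanish, although one term is positive because three distinct unit vectors are never all parallel
(`barycenter_unique`). Smoothness: at a solution the derivative of the equation in `w` is a nonzero
multiple of P = ∑ rᵢ(I - yᵢyᵢᵀ), yᵢ = σ(w,xᵢ), which is invertible for the same reason. The implicit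
function theorem applies, and uniqueness identifies its local branch with w_*.

Jacobian: on the sphere σ(-w,·) is an inversion followed by a translation. Its differential sends a
tangent vector (u,v) to λᵢ Rᵢ(vᵢ + Aᵢu), with λᵢ = (1-|w|²)/|yᵢ+w|², a reflection Rᵢ, and Aᵢ linear
(`fderiv_sphereShift_tangent`). Reflections disappear from inner products. The tangent space is ℝᵈ ×
ker c with c(v) = ∑ rᵢvᵢ, and for such maps the Gram determinant is det(cA)² det(X) / det(cc*), X
being multiplication by λᵢ² (`det_gram_of_ker`). Closedness of y gives cA = (2/(1-|w|²)) P, the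
metric gives cc* = ∑ (rᵢ²/ϱᵢ²)(I - yᵢyᵢᵀ), and det X = ∏ λᵢ^(2(d-1)).

Complexity: the formula consists of a bounded number (depending on d) of sums and products over
edges, each a single loop with constant work per edge. The predicate `Computes` composes such
programs together with their time and space bounds. -/

noncomputable section

namespace ConformalPolygon

/-! ### Algebra of the shift map -/

section ShiftAlgebra

variable {d : ℕ}

/-- The denominator in the definition of `shift`. -/
def shiftDen (w z : Vec d) : ℝ := 1 - 2 * inner ℝ w z + ‖w‖ ^ 2 * ‖z‖ ^ 2

theorem norm_sq_lt_one {w : Vec d} (hw : w ∈ unitBall d) : ‖w‖ ^ 2 < 1 := by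
  have : ‖w‖ < 1 := by simpa [unitBall] using hw
  nlinarith [norm_nonneg w]

theorem mem_unitBall_iff {w : Vec d} : w ∈ unitBall d ↔ ‖w‖ < 1 := by simp [unitBall]

theorem mem_unitBall_of_norm_sq {w : Vec d} (h : ‖w‖ ^ 2 < 1) : w ∈ unitBall d := by
  rw [mem_unitBall_iff]
  nlinarith [norm_nonneg w]

theorem neg_mem_unitBall {w : Vec d} (hw : w ∈ unitBall d) : -w ∈ unitBall d := by
  simpa [mem_unitBall_iff] using hw

/-- By Cauchy–Schwarz the denominator is at least (1 - ‖w‖‖z‖)². Ideal points, ‖z‖ = 1, are covered.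
-/
theorem shiftDen_pos {w z : Vec d} (hw : w ∈ unitBall d) (hz : ‖z‖ ≤ 1) : 0 < shiftDen w z := by
  rw [mem_unitBall_iff] at hw
  have h1 := real_inner_le_norm w z
  have h2 : ‖w‖ * ‖z‖ < 1 := by nlinarith [norm_nonneg w, norm_nonneg z]
  unfold shiftDen
  nlinarith [sq_pos_of_pos (sub_pos.2 h2)]

theorem shift_eq (w z : Vec d) : shift w z = ((1 - ‖w‖ ^ 2) / shiftDen w z) • z +
    (-(1 + ‖z‖ ^ 2 - 2 * inner ℝ w z) / shiftDen w z) • w := by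
  unfold shift
  rw [← shiftDen]
  module

theorem norm_sq_lincomb (α β : ℝ) (a b : Vec d) :
    ‖α • a + β • b‖ ^ 2 = α ^ 2 * ‖a‖ ^ 2 + 2 * α * β * inner ℝ a b + β ^ 2 * ‖b‖ ^ 2 := by
  rw [norm_add_sq_real, norm_smul, norm_smul, real_inner_smul_left, real_inner_smul_right,
    mul_pow, mul_pow, Real.norm_eq_abs, Real.norm_eq_abs, sq_abs, sq_abs]
  ring

theorem norm_sq_lincomb_three (α β γ : ℝ) (a b c : Vec d) :
    ‖α • a + β • b + γ • c‖ ^ 2 = α ^ 2 * ‖a‖ ^ 2 + β ^ 2 * ‖b‖ ^ 2 + γ ^ 2 * ‖c‖ ^ 2 +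
      2 * α * β * inner ℝ a b + 2 * α * γ * inner ℝ c a + 2 * β * γ * inner ℝ c b := by
  rw [norm_add_sq_real, norm_sq_lincomb, norm_smul, mul_pow, Real.norm_eq_abs, sq_abs,
    inner_add_left, real_inner_smul_left, real_inner_smul_left, real_inner_smul_right,
    real_inner_smul_right, real_inner_comm a c, real_inner_comm b c]
  ring

/-- The reason that the shift preserves both the ball and the sphere; with `norm_sq_shift_sub` it
makes the shift a hyperbolic isometry. -/
theorem one_sub_norm_sq_shift {w z : Vec d} (h : shiftDen w z ≠ 0) :
    1 - ‖shift w z‖ ^ 2 = (1 - ‖w‖ ^ 2) * (1 - ‖z‖ ^ 2) / shiftDen w z := by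
  rw [shift_eq, norm_sq_lincomb, real_inner_comm w z]
  field_simp
  unfold shiftDen
  ring

theorem inner_shift {w z : Vec d} (h : shiftDen w z ≠ 0) :
    inner ℝ w (shift w z) =
      ((1 - ‖w‖ ^ 2) * inner ℝ w z - (1 + ‖z‖ ^ 2 - 2 * inner ℝ w z) * ‖w‖ ^ 2) /
        shiftDen w z := by
  rw [shift_eq, inner_add_right, real_inner_smul_right, real_inner_smul_right,
    real_inner_self_eq_norm_sq]
  field_simp
  ring

theorem norm_sq_shift_sub {w a b : Vec d} (ha : shiftDen w a ≠ 0) (hb : shiftDen w b ≠ 0) :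
    ‖shift w a - shift w b‖ ^ 2 =
      (1 - ‖w‖ ^ 2) ^ 2 * ‖a - b‖ ^ 2 / (shiftDen w a * shiftDen w b) := by
  have h1 : shift w a - shift w b = ((1 - ‖w‖ ^ 2) / shiftDen w a) • a +
      (-((1 - ‖w‖ ^ 2) / shiftDen w b)) • b +
      (-(1 + ‖a‖ ^ 2 - 2 * inner ℝ w a) / shiftDen w a +
        (1 + ‖b‖ ^ 2 - 2 * inner ℝ w b) / shiftDen w b) • w := by
    rw [shift_eq, shift_eq]; module
  rw [h1, norm_sq_lincomb_three, norm_sub_sq_real]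
  field_simp
  unfold shiftDen
  ring

theorem shift_neg_shift {w z : Vec d} (hw : w ∈ unitBall d) (hz : ‖z‖ ≤ 1) :
    shift (-w) (shift w z) = z := by
  have hD := (shiftDen_pos hw hz).ne'
  have hq : 1 - ‖w‖ ^ 2 ≠ 0 := (sub_pos.2 (norm_sq_lt_one hw)).ne'
  have hb : ‖shift w z‖ ^ 2 = 1 - (1 - ‖w‖ ^ 2) * (1 - ‖z‖ ^ 2) / shiftDen w z := by
    linarith [one_sub_norm_sq_shift hD]
  have hD' : shiftDen (-w) (shift w z) = (1 - ‖w‖ ^ 2) ^ 2 / shiftDen w z := by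
    rw [shiftDen, norm_neg, inner_neg_left, inner_shift hD, hb]
    field_simp
    unfold shiftDen
    ring
  -- This is the coefficient of `w` in the numerator of the double shift. It vanishes, and `hD'`
  -- then makes the coefficient of `z` equal to 1.
  have hc : (1 - ‖w‖ ^ 2) * (-(1 + ‖z‖ ^ 2 - 2 * inner ℝ w z) / shiftDen w z) +
      (1 + ‖shift w z‖ ^ 2 + 2 * inner ℝ w (shift w z)) = 0 := by
    rw [inner_shift hD, hb]
    field_simp
    unfold shiftDen
    ring
  have h1 : shift (-w) (shift w z) = (shiftDen (-w) (shift w z))⁻¹ •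
      (((1 - ‖w‖ ^ 2) * ((1 - ‖w‖ ^ 2) / shiftDen w z)) • z +
        ((1 - ‖w‖ ^ 2) * (-(1 + ‖z‖ ^ 2 - 2 * inner ℝ w z) / shiftDen w z) +
          (1 + ‖shift w z‖ ^ 2 + 2 * inner ℝ w (shift w z))) • w) := by
    conv_lhs => rw [shift, ← shiftDen]
    congr 1
    rw [norm_neg, inner_neg_left]
    generalize ‖shift w z‖ ^ 2 = B
    generalize inner ℝ w (shift w z) = C
    rw [shift_eq]
    module
  rw [h1, hc, hD', zero_smul, add_zero, smul_smul]
  convert one_smul ℝ z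
  field_simp

theorem shift_shift_neg {w z : Vec d} (hw : w ∈ unitBall d) (hz : ‖z‖ ≤ 1) :
    shift w (shift (-w) z) = z := by
  simpa using shift_neg_shift (neg_mem_unitBall hw) hz

theorem shift_mem_unitBall {w z : Vec d} (hw : w ∈ unitBall d) (hz : z ∈ unitBall d) :
    shift w z ∈ unitBall d := by
  have hz1 : ‖z‖ ≤ 1 := (mem_unitBall_iff.1 hz).le
  have hD := shiftDen_pos hw hz1
  apply mem_unitBall_of_norm_sq
  have h := one_sub_norm_sq_shift hD.ne'
  have : 0 < (1 - ‖w‖ ^ 2) * (1 - ‖z‖ ^ 2) / shiftDen w z :=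
    div_pos (mul_pos (by linarith [norm_sq_lt_one hw]) (by linarith [norm_sq_lt_one hz])) hD
  linarith

theorem norm_shift_eq_one {w x : Vec d} (hw : w ∈ unitBall d) (hx : ‖x‖ = 1) :
    ‖shift w x‖ = 1 := by
  have h := one_sub_norm_sq_shift (shiftDen_pos hw hx.le).ne'
  rw [hx] at h
  have h2 : ‖shift w x‖ ^ 2 = 1 := by simp at h; linarith
  exact (pow_eq_one_iff_of_nonneg (norm_nonneg _) two_ne_zero).1 h2

theorem shiftDen_eq_norm_sub {w x : Vec d} (hx : ‖x‖ = 1) : shiftDen w x = ‖x - w‖ ^ 2 := by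
  rw [shiftDen, norm_sub_sq_real, hx, real_inner_comm]
  ring

theorem sub_ne_zero_of_unit {w x : Vec d} (hw : w ∈ unitBall d) (hx : ‖x‖ = 1) :
    0 < ‖x - w‖ ^ 2 := by
  rw [← shiftDen_eq_norm_sub hx]
  exact shiftDen_pos hw hx.le

/-- On the unit sphere the shift map is an inversion followed by a translation. -/
theorem shift_eq_of_unit {w x : Vec d} (hw : w ∈ unitBall d) (hx : ‖x‖ = 1) :
    shift w x = ((1 - ‖w‖ ^ 2) / ‖x - w‖ ^ 2) • (x - w) - w := by
  have h0 := (sub_ne_zero_of_unit hw hx).ne'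
  have key : -(1 + ‖x‖ ^ 2 - 2 * inner ℝ w x) / ‖x - w‖ ^ 2 =
      -((1 - ‖w‖ ^ 2) / ‖x - w‖ ^ 2) - 1 := by
    have e : ‖x - w‖ ^ 2 = 1 - 2 * inner ℝ x w + ‖w‖ ^ 2 := by
      rw [norm_sub_sq_real, hx]; ring
    rw [e] at h0 ⊢
    rw [hx, real_inner_comm]
    field_simp
    ring
  rw [shift_eq, shiftDen_eq_norm_sub hx, key]
  module

theorem shift_self (w : Vec d) : shift w w = 0 := by
  rw [shift, ← sub_smul, real_inner_self_eq_norm_sq]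
  simp
  right; left; ring

theorem shift_apply_zero (w : Vec d) : shift w 0 = -w := by simp [shift]

theorem shift_zero_left (z : Vec d) : shift 0 z = z := by simp [shift]

end ShiftAlgebra

/-! ### Geodesic rays and directors -/

section Directors

open Filter Topology

variable {d : ℕ}

theorem tendsto_tanh_atTop : Tendsto Real.tanh atTop (𝓝 1) := by
  have h1 : Tendsto (fun x : ℝ => Real.exp (-(2 * x))) atTop (𝓝 0) :=
    Real.tendsto_exp_neg_atTop_nhds_zero.comp (tendsto_id.const_mul_atTop two_pos)
  have h2 : Tendsto (fun x : ℝ => (1 - Real.exp (-(2 * x))) / (1 + Real.exp (-(2 * x)))) atTop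
      (𝓝 ((1 - 0) / (1 + 0))) := (h1.const_sub 1).div (h1.const_add 1) (by norm_num)
  simp only [sub_zero, add_zero, div_one] at h2
  refine h2.congr fun x => ?_
  rw [Real.tanh_eq_sinh_div_cosh, Real.sinh_eq, Real.cosh_eq]
  have h3 : Real.exp (-(2 * x)) = Real.exp (-x) / Real.exp x := by
    rw [← Real.exp_sub]; ring_nf
  have h4 := Real.exp_pos x
  have h5 := Real.exp_pos (-x)
  rw [h3]
  field_simp

theorem one_sub_tanh_sq (t : ℝ) : 1 - Real.tanh t ^ 2 = (Real.cosh t ^ 2)⁻¹ := by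
  have h := Real.cosh_sq t
  have hc := (Real.cosh_pos t).ne'
  rw [Real.tanh_eq_sinh_div_cosh]
  field_simp
  linarith

theorem tanh_sub_tanh (s t : ℝ) :
    Real.tanh s - Real.tanh t = Real.sinh (s - t) / (Real.cosh s * Real.cosh t) := by
  have hc := (Real.cosh_pos t).ne'
  have hs := (Real.cosh_pos s).ne'
  rw [Real.tanh_eq_sinh_div_cosh, Real.tanh_eq_sinh_div_cosh, Real.sinh_sub]
  field_simp

/-- For a unit vector z this says that t ↦ tanh(t/2) z has unit speed for `hypDist`; conversely it
yields ‖c t‖ = tanh(t/2) along any ray c from the origin. -/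
theorem cosh_sub_eq_tanh_half (s t : ℝ) :
    1 + 2 * (Real.tanh (s / 2) - Real.tanh (t / 2)) ^ 2 /
      ((1 - Real.tanh (s / 2) ^ 2) * (1 - Real.tanh (t / 2) ^ 2)) = Real.cosh (s - t) := by
  have h1 := (Real.cosh_pos (t / 2)).ne'
  have h2 := (Real.cosh_pos (s / 2)).ne'
  have h3 : Real.cosh (s - t) = 1 + 2 * Real.sinh (s / 2 - t / 2) ^ 2 := by
    rw [show s - t = 2 * (s / 2 - t / 2) by ring, Real.cosh_two_mul, Real.cosh_sq]
    ring
  rw [one_sub_tanh_sq, one_sub_tanh_sq, tanh_sub_tanh, h3]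
  field_simp

theorem cosh_hypDist {u v : Vec d} (hu : u ∈ unitBall d) (hv : v ∈ unitBall d) :
    Real.cosh (hypDist u v) = 1 + 2 * ‖u - v‖ ^ 2 / ((1 - ‖u‖ ^ 2) * (1 - ‖v‖ ^ 2)) := by
  have h1 := sub_pos.2 (norm_sq_lt_one hu)
  have h2 := sub_pos.2 (norm_sq_lt_one hv)
  rw [hypDist, Real.cosh_arcosh]
  have : 0 ≤ 2 * ‖u - v‖ ^ 2 / ((1 - ‖u‖ ^ 2) * (1 - ‖v‖ ^ 2)) := by positivity
  linarith

theorem hypDist_shift {w u v : Vec d} (hw : w ∈ unitBall d) (hu : u ∈ unitBall d)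
    (hv : v ∈ unitBall d) : hypDist (shift w u) (shift w v) = hypDist u v := by
  have hDu := (shiftDen_pos hw (mem_unitBall_iff.1 hu).le).ne'
  have hDv := (shiftDen_pos hw (mem_unitBall_iff.1 hv).le).ne'
  have h0 := (sub_pos.2 (norm_sq_lt_one hw)).ne'
  have h1 := (sub_pos.2 (norm_sq_lt_one hu)).ne'
  have h2 := (sub_pos.2 (norm_sq_lt_one hv)).ne'
  rw [hypDist, hypDist, one_sub_norm_sq_shift hDu, one_sub_norm_sq_shift hDv,
    norm_sq_shift_sub hDu hDv]
  congr 2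
  field_simp

theorem abs_tanh_lt_one (t : ℝ) : |Real.tanh t| < 1 := by
  have h1 : 0 < (Real.cosh t ^ 2)⁻¹ := by have := Real.cosh_pos t; positivity
  rw [← one_sub_tanh_sq] at h1
  exact (sq_lt_one_iff_abs_lt_one _).1 (by linarith)

theorem norm_tanh_smul {z : Vec d} (hz : ‖z‖ = 1) (t : ℝ) :
    ‖Real.tanh t • z‖ = |Real.tanh t| := by
  rw [norm_smul, hz, mul_one, Real.norm_eq_abs]

theorem tanh_smul_mem_unitBall {z : Vec d} (hz : ‖z‖ = 1) (t : ℝ) :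
    Real.tanh t • z ∈ unitBall d := by
  rw [mem_unitBall_iff, norm_tanh_smul hz]
  exact abs_tanh_lt_one t

/-- Allowing ‖z‖ = 1 lets limits at infinity of rays be transported by the translation. -/
theorem continuousAt_shift {w z : Vec d} (hw : w ∈ unitBall d) (hz : ‖z‖ ≤ 1) :
    ContinuousAt (shift w) z := by
  have h : (1 - 2 * inner ℝ w z + ‖w‖ ^ 2 * ‖z‖ ^ 2) ≠ 0 := (shiftDen_pos hw hz).ne'
  unfold shift
  fun_prop (disch := exact h)

/-- The unit speed geodesic ray from `w` to `x`. -/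
def geodesicRay (w x : Vec d) (t : ℝ) : Vec d := shift (-w) (Real.tanh (t / 2) • shift w x)

theorem isGeodesicRay_geodesicRay {w x : Vec d} (hw : w ∈ unitBall d) (hx : ‖x‖ = 1) :
    IsGeodesicRay w x (geodesicRay w x) := by
  have hz := norm_shift_eq_one hw hx
  have hb := fun t : ℝ => tanh_smul_mem_unitBall hz (t / 2)
  refine ⟨fun t _ => shift_mem_unitBall (neg_mem_unitBall hw) (hb t), fun s t _ _ => ?_, ?_, ?_⟩
  · rw [geodesicRay, geodesicRay, hypDist_shift (neg_mem_unitBall hw) (hb s) (hb t), hypDist,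
      ← sub_smul, norm_smul, hz, mul_one, norm_tanh_smul hz, norm_tanh_smul hz, sq_abs, sq_abs,
      Real.norm_eq_abs, sq_abs, cosh_sub_eq_tanh_half, ← Real.cosh_abs,
      Real.arcosh_cosh (abs_nonneg _)]
  · simp [geodesicRay, shift_apply_zero]
  · have h1 : Tendsto (fun t : ℝ => Real.tanh (t / 2) • shift w x) atTop
        (𝓝 ((1 : ℝ) • shift w x)) :=
      (tendsto_tanh_atTop.comp (tendsto_id.atTop_div_const two_pos)).smul_const _
    rw [one_smul] at h1
    have h2 := (continuousAt_shift (neg_mem_unitBall hw) hz.le).tendsto.comp h1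
    rw [shift_neg_shift hw hx.le] at h2
    exact h2

theorem hasDerivAt_geodesicRay {w x : Vec d} (hw : w ∈ unitBall d) (hx : ‖x‖ = 1) :
    HasDerivAt (geodesicRay w x) (((1 - ‖w‖ ^ 2) / 2) • shift w x) 0 := by
  have hz := norm_shift_eq_one hw hx
  set z := shift w x with hzdef
  have hτ : HasDerivAt (fun t : ℝ => Real.tanh (t / 2)) (1 / 2) 0 := by
    have h1 : HasDerivAt (fun t : ℝ => t / 2) (1 / 2) 0 := (hasDerivAt_id 0).div_const 2
    have h2 := (h1.sinh).div (h1.cosh) (Real.cosh_pos _).ne'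
    simp only [zero_div, Real.sinh_zero, Real.cosh_zero] at h2
    refine (h2.congr_deriv (by norm_num)).congr_of_eventuallyEq ?_
    exact Eventually.of_forall fun t => Real.tanh_eq_sinh_div_cosh _
  set c : ℝ := inner ℝ w z
  have hσ : HasDerivAt (fun τ : ℝ => shift (-w) (τ • z)) ((1 - ‖w‖ ^ 2) • z) 0 := by
    have hid := hasDerivAt_id (0 : ℝ)
    have hD : HasDerivAt (fun τ : ℝ => 1 + 2 * τ * c + ‖w‖ ^ 2 * τ ^ 2) (2 * c) 0 := by
      have := (((hid.const_mul 2).mul_const c).const_add 1).fun_add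
        ((hid.fun_pow 2).const_mul (‖w‖ ^ 2))
      simpa using this
    have hN : HasDerivAt (fun τ : ℝ => ((1 - ‖w‖ ^ 2) * τ) • z + (1 + τ ^ 2 + 2 * τ * c) • w)
        ((1 - ‖w‖ ^ 2) • z + (2 * c) • w) 0 := by
      have h1 := (hid.const_mul (1 - ‖w‖ ^ 2)).smul_const z
      have h2 := ((((hid.fun_pow 2)).const_add 1).fun_add
        ((hid.const_mul 2).mul_const c)).smul_const w
      simpa using h1.fun_add h2
    have := (hD.fun_inv (by simp)).smul hN
    simp only [mul_zero, zero_mul, add_zero, ne_eq, OfNat.ofNat_ne_zero, not_false_eq_true,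
      zero_pow, inv_one, one_smul, one_pow, div_one, zero_smul, zero_add] at this
    -- The first-order terms 2c • w of the numerator and of the inverse denominator cancel, which
    -- leaves (1 - ‖w‖²) • z.
    refine (this.congr_deriv (by module)).congr_of_eventuallyEq (Eventually.of_forall fun τ => ?_)
    simp only [shift, norm_smul, hz, inner_smul_right, inner_neg_left, norm_neg, Real.norm_eq_abs,
      mul_one, sq_abs]
    congr 1
    · congr 1; simp only [c]; ring
    · simp only [c]; module
  have h0 : Real.tanh (0 / 2) = 0 := by simp
  have := HasDerivAt.scomp_of_eq (0 : ℝ) hσ hτ h0.symm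
  refine this.congr_deriv ?_
  rw [smul_smul]
  congr 1
  ring

/-- Translate `w` to the origin. Distances to the origin fix the norms, distances between two points
force equality in Cauchy–Schwarz, so the curve stays on one Euclidean ray, and the limit at infinity
fixes its direction. -/
theorem IsGeodesicRay.eq_geodesicRay {w x : Vec d} (hw : w ∈ unitBall d) (hx : ‖x‖ = 1)
    {γ : ℝ → Vec d} (h : IsGeodesicRay w x γ) {t : ℝ} (ht : 0 ≤ t) : γ t = geodesicRay w x t := by
  set c : ℝ → Vec d := fun t => shift w (γ t) with hc
  have hcb : ∀ t, 0 ≤ t → c t ∈ unitBall d := fun t ht => shift_mem_unitBall hw (h.mem_ball t ht)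
  have hdist : ∀ s t, 0 ≤ s → 0 ≤ t →
      1 + 2 * ‖c s - c t‖ ^ 2 / ((1 - ‖c s‖ ^ 2) * (1 - ‖c t‖ ^ 2)) = Real.cosh (s - t) := by
    intro s t hs ht
    rw [← cosh_hypDist (hcb s hs) (hcb t ht),
      hypDist_shift hw (h.mem_ball s hs) (h.mem_ball t ht), h.isometry s t hs ht, Real.cosh_abs]
  have hc0 : c 0 = 0 := by rw [hc]; simp only [h.start]; exact shift_self w
  have hnonneg : ∀ t, 0 ≤ t → 0 ≤ Real.tanh (t / 2) := fun t ht => by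
    rw [Real.tanh_eq_sinh_div_cosh]
    exact div_nonneg (Real.sinh_nonneg_iff.2 (by linarith)) (Real.cosh_pos _).le
  have hnorm : ∀ t, 0 ≤ t → ‖c t‖ = Real.tanh (t / 2) := by
    intro t ht
    have h1 := hdist t 0 ht le_rfl
    have h2 := cosh_sub_eq_tanh_half t 0
    rw [← h1, hc0] at h2
    have hb := sub_pos.2 (norm_sq_lt_one (hcb t ht))
    have hb' : 0 < 1 - Real.tanh (t / 2) ^ 2 := by
      rw [one_sub_tanh_sq]; have := Real.cosh_pos (t / 2); positivity
    simp only [zero_div, Real.tanh_zero, sub_zero, norm_zero, ne_eq, OfNat.ofNat_ne_zero,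
      not_false_eq_true, zero_pow, mul_one, add_right_inj] at h2
    rw [div_eq_div_iff hb'.ne' hb.ne'] at h2
    have h3 : ‖c t‖ ^ 2 = Real.tanh (t / 2) ^ 2 := by linarith
    exact (pow_left_inj₀ (norm_nonneg _) (hnonneg t ht) two_ne_zero).1 h3
  -- The distance formula reduces to ‖c s - c t‖ = |‖c s‖ - ‖c t‖|, the equality case of
  -- Cauchy–Schwarz.
  have hcol : ∀ s t, 0 ≤ s → 0 ≤ t → ‖c t‖ • c s = ‖c s‖ • c t := by
    intro s t hs ht
    have h1 := hdist s t hs ht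
    rw [← cosh_sub_eq_tanh_half, ← hnorm s hs, ← hnorm t ht] at h1
    have hb := sub_pos.2 (norm_sq_lt_one (hcb s hs))
    have hb' := sub_pos.2 (norm_sq_lt_one (hcb t ht))
    rw [add_right_inj, div_left_inj' (mul_pos hb hb').ne'] at h1
    rw [← inner_eq_norm_mul_iff_real]
    have h2 := norm_sub_sq_real (c s) (c t)
    nlinarith
  have hlim : Tendsto c atTop (𝓝 (shift w x)) :=
    (continuousAt_shift hw hx.le).tendsto.comp h.limit
  have hfin : c t = Real.tanh (t / 2) • shift w x := by
    have h1 : Tendsto (fun s => ‖c s‖ • c t) atTop (𝓝 (‖shift w x‖ • c t)) :=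
      hlim.norm.smul_const _
    have h2 : Tendsto (fun s => ‖c t‖ • c s) atTop (𝓝 (‖c t‖ • shift w x)) := hlim.const_smul _
    have h3 := tendsto_nhds_unique (h1.congr' ?_) h2
    · rw [norm_shift_eq_one hw hx, one_smul, hnorm t ht] at h3
      exact h3
    · filter_upwards [eventually_ge_atTop 0] with s hs using hcol t s ht hs
  rw [geodesicRay, ← hfin, hc]
  exact (shift_neg_shift hw (mem_unitBall_iff.1 (h.mem_ball t ht)).le).symm

/-- The factor gives the Euclidean unit vector `shift w x` hyperbolic length 1 at `w`. -/
theorem isDirector_iff {w x v : Vec d} (hw : w ∈ unitBall d) (hx : ‖x‖ = 1) :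
    IsDirector w x v ↔ v = ((1 - ‖w‖ ^ 2) / 2) • shift w x := by
  have hd := (hasDerivAt_geodesicRay hw hx).hasDerivWithinAt (s := Set.Ici 0)
  constructor
  · rintro ⟨γ, hγ, hv⟩
    have h1 := hv.congr (fun t ht => (hγ.eq_geodesicRay hw hx ht).symm)
      (hγ.eq_geodesicRay hw hx le_rfl).symm
    -- A ray is constrained only for t ≥ 0, so one-sided derivatives are compared.
    exact (uniqueDiffOn_Ici (0 : ℝ) 0 Set.self_mem_Ici).eq_deriv _ h1 hd
  · rintro rfl
    exact ⟨_, isGeodesicRay_geodesicRay hw hx, hd⟩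

theorem isConformalBarycenter_iff {n : ℕ} {r : Fin n → ℝ} {x : Fin n → Vec d}
    (hx : x ∈ Arm d n) {w : Vec d} :
    IsConformalBarycenter r x w ↔ w ∈ unitBall d ∧ ∑ i, r i • shift w (x i) = 0 := by
  unfold IsConformalBarycenter
  refine and_congr_right fun hw => ?_
  have hq : (1 - ‖w‖ ^ 2) / 2 ≠ 0 := by linarith [norm_sq_lt_one hw]
  have hsum : ∑ i, r i • ((1 - ‖w‖ ^ 2) / 2) • shift w (x i) =
      ((1 - ‖w‖ ^ 2) / 2) • ∑ i, r i • shift w (x i) := by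
    rw [Finset.smul_sum]
    exact Finset.sum_congr rfl fun i _ => smul_comm _ _ _
  constructor
  · rintro ⟨V, hV, h⟩
    simp only [fun i => (isDirector_iff hw (hx i)).1 (hV i)] at h
    rw [hsum] at h
    exact (smul_eq_zero.1 h).resolve_left hq
  · intro h
    exact ⟨fun i => ((1 - ‖w‖ ^ 2) / 2) • shift w (x i),
      fun i => (isDirector_iff hw (hx i)).2 rfl, by rw [hsum, h, smul_zero]⟩

end Directors

/-! ### Existence and uniqueness of the conformal barycenter -/

section Barycenter

open Filter Topology

variable {d n : ℕ}

theorem inner_sq_le_of_unit {y : Vec d} (hy : ‖y‖ = 1) (u : Vec d) :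
    inner ℝ y u ^ 2 ≤ ‖u‖ ^ 2 := by
  have h := abs_real_inner_le_norm y u
  rw [hy, one_mul] at h
  exact sq_le_sq' (by linarith [neg_abs_le (inner ℝ y u : ℝ)]) ((le_abs_self _).trans h)

/-- Three distinct unit vectors are not all parallel to a given vector. -/
theorem exists_inner_sq_lt (hn : 3 ≤ n) {y : Fin n → Vec d} (hy : y ∈ ArmX d n) {u : Vec d}
    (hu : u ≠ 0) : ∃ i, inner ℝ (y i) u ^ 2 < ‖u‖ ^ 2 := by
  by_contra! hcon
  have hu0 : 0 < ‖u‖ := norm_pos_iff.2 hu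
  -- Equality in Cauchy–Schwarz leaves two possible values, which three distinct vectors cannot
  -- share.
  have key : ∀ i, ‖u‖ • y i = u ∨ ‖u‖ • y i = -u := by
    intro i
    have h1 := le_antisymm (inner_sq_le_of_unit (hy.1 i) u) (hcon i)
    rcases sq_eq_sq_iff_eq_or_eq_neg.1 h1 with h2 | h2
    · left
      have h3 := (inner_eq_norm_mul_iff_real (x := y i) (y := u)).1 (by rw [h2, hy.1 i, one_mul])
      rwa [hy.1 i, one_smul] at h3
    · right
      have h3 := (inner_eq_norm_mul_iff_real (x := y i) (y := -u)).1
        (by rw [inner_neg_right, h2, hy.1 i, norm_neg]; ring)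
      rwa [hy.1 i, one_smul, norm_neg] at h3
  have inj : ∀ i j, i ≠ j → ‖u‖ • y i ≠ ‖u‖ • y j := fun i j hij h =>
    hy.2 i j hij (smul_right_injective _ hu0.ne' h)
  have h01 := inj ⟨0, by omega⟩ ⟨1, by omega⟩ (by simp)
  have h02 := inj ⟨0, by omega⟩ ⟨2, by omega⟩ (by simp)
  have h12 := inj ⟨1, by omega⟩ ⟨2, by omega⟩ (by simp)
  rcases key ⟨0, by omega⟩ with h0 | h0 <;> rcases key ⟨1, by omega⟩ with h1 | h1 <;>
    rcases key ⟨2, by omega⟩ with h2 | h2 <;> simp_all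

/-- The quadratic form of ∑ cᵢ(I - yᵢyᵢᵀ) is positive definite. Every nondegeneracy used for the
submanifold, the implicit function theorem and the Jacobian comes from here. -/
theorem sum_norm_sq_sub_inner_sq_pos (hn : 3 ≤ n) {y : Fin n → Vec d} (hy : y ∈ ArmX d n)
    {c : Fin n → ℝ} (hc : ∀ i, 0 < c i) {u : Vec d} (hu : u ≠ 0) :
    0 < ∑ i, c i * (‖u‖ ^ 2 - inner ℝ (y i) u ^ 2) := by
  obtain ⟨i, hi⟩ := exists_inner_sq_lt hn hy hu
  exact Finset.sum_pos' (fun i _ => mul_nonneg (hc i).le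
    (sub_nonneg.2 (inner_sq_le_of_unit (hy.1 i) u))) ⟨i, Finset.mem_univ _,
      mul_pos (hc i) (sub_pos.2 hi)⟩

theorem shift_injOn_sphere {w a b : Vec d} (hw : w ∈ unitBall d) (ha : ‖a‖ = 1) (hb : ‖b‖ = 1)
    (h : shift w a = shift w b) : a = b := by
  rw [← shift_neg_shift hw ha.le, h, shift_neg_shift hw hb.le]

theorem shift_mem_ArmX {w : Vec d} (hw : w ∈ unitBall d) {x : Fin n → Vec d} (hx : x ∈ ArmX d n) :
    (fun i => shift w (x i)) ∈ ArmX d n :=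
  ⟨fun i => norm_shift_eq_one hw (hx.1 i), fun i j hij h =>
    hx.2 i j hij (shift_injOn_sphere hw (hx.1 i) (hx.1 j) h)⟩

theorem shiftDen_comm (w v : Vec d) : shiftDen w v = shiftDen v w := by
  unfold shiftDen
  rw [real_inner_comm]
  ring

/-- Put zᵢ = σ(w,xᵢ), zᵢ' = σ(w',xᵢ), v = σ(w,w'), v' = σ(w',w). Then |v| = |v'| and |zᵢ-v||zᵢ'-v'|
= 1-|v|². Expanding the squares yields ⟨zᵢ,v⟩ + ⟨zᵢ',v'⟩ = 2(|v|² - ⟨zᵢ,v⟩²)/|zᵢ-v|² ≥ 0. The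
weighted sum of the left sides is zero by the two barycenter equations, yet some right side is
positive. -/
theorem barycenter_unique (hn : 3 ≤ n) {r : Fin n → ℝ} (hr : ∀ i, 0 < r i) {x : Fin n → Vec d}
    (hx : x ∈ ArmX d n) {w w' : Vec d} (hw : w ∈ unitBall d) (hw' : w' ∈ unitBall d)
    (h : ∑ i, r i • shift w (x i) = 0) (h' : ∑ i, r i • shift w' (x i) = 0) : w = w' := by
  by_contra hne
  have hD : shiftDen w w' ≠ 0 := (shiftDen_pos hw (mem_unitBall_iff.1 hw').le).ne'
  have hD' : shiftDen w' w ≠ 0 := by rwa [shiftDen_comm]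
  have hq := sub_pos.2 (norm_sq_lt_one hw)
  have hq' := sub_pos.2 (norm_sq_lt_one hw')
  set v := shift w w' with hv
  set v' := shift w' w with hv'
  have hv0 : v ≠ 0 := by
    intro h0
    have := shift_neg_shift hw (mem_unitBall_iff.1 hw').le
    rw [← hv, h0, shift_apply_zero, neg_neg] at this
    exact hne this
  have hvb : v ∈ unitBall d := shift_mem_unitBall hw hw'
  have hV := sub_pos.2 (norm_sq_lt_one hvb)
  have hVV : ‖v'‖ ^ 2 = ‖v‖ ^ 2 := by
    have h1 := one_sub_norm_sq_shift hD
    have h2 := one_sub_norm_sq_shift hD'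
    rw [shiftDen_comm, mul_comm] at h2
    linarith
  have hvb' : v' ∈ unitBall d := mem_unitBall_of_norm_sq (by rw [hVV]; linarith)
  have hz := fun i => norm_shift_eq_one hw (hx.1 i)
  have hz' := fun i => norm_shift_eq_one hw' (hx.1 i)
  have exp1 : ∀ i, ‖shift w (x i) - v‖ ^ 2 = 1 + ‖v‖ ^ 2 - 2 * inner ℝ (shift w (x i)) v := by
    intro i; rw [norm_sub_sq_real, hz i]; ring
  have exp2 : ∀ i, ‖shift w' (x i) - v'‖ ^ 2 =
      1 + ‖v‖ ^ 2 - 2 * inner ℝ (shift w' (x i)) v' := by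
    intro i; rw [norm_sub_sq_real, hz' i, hVV]; ring
  -- `norm_sq_shift_sub` applies to both factors, and the distances from xᵢ to `w` and `w'` cancel.
  have hprod : ∀ i, ‖shift w (x i) - v‖ ^ 2 * ‖shift w' (x i) - v'‖ ^ 2 = (1 - ‖v‖ ^ 2) ^ 2 := by
    intro i
    have p1 := (shiftDen_pos hw (hx.1 i).le)
    have p2 := (shiftDen_pos hw' (hx.1 i).le)
    rw [hv, hv', norm_sq_shift_sub p1.ne' hD, norm_sq_shift_sub p2.ne' hD',
      one_sub_norm_sq_shift hD, shiftDen_comm w' w, ← shiftDen_eq_norm_sub (hx.1 i),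
      ← shiftDen_eq_norm_sub (hx.1 i)]
    field_simp
  have zero_inner : ∀ (z : Fin n → Vec d) (u : Vec d), ∑ i, r i • z i = 0 →
      ∑ i, r i * inner ℝ (z i) u = 0 := by
    intro z u hz
    have : inner ℝ (∑ i, r i • z i) u = 0 := by rw [hz, inner_zero_left]
    rw [sum_inner] at this
    simpa only [real_inner_smul_left] using this
  have s1 := zero_inner _ v h
  have s2 := zero_inner _ v' h'
  obtain ⟨i0, hi0⟩ := exists_inner_sq_lt hn (shift_mem_ArmX hw hx) hv0
  have hle : ∀ i, 0 ≤ r i * (inner ℝ (shift w (x i)) v + inner ℝ (shift w' (x i)) v') := by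
    intro i
    refine mul_nonneg (hr i).le ?_
    have hA : 0 < 1 + ‖v‖ ^ 2 - 2 * inner ℝ (shift w (x i)) v := by
      rw [← exp1]; exact sub_ne_zero_of_unit hvb (hz i)
    have hp := hprod i
    rw [exp1, exp2] at hp
    have := inner_sq_le_of_unit (hz i) v
    nlinarith
  have hlt : 0 < r i0 * (inner ℝ (shift w (x i0)) v + inner ℝ (shift w' (x i0)) v') := by
    refine mul_pos (hr i0) ?_
    have hA : 0 < 1 + ‖v‖ ^ 2 - 2 * inner ℝ (shift w (x i0)) v := by
      rw [← exp1]; exact sub_ne_zero_of_unit hvb (hz i0)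
    have hp := hprod i0
    rw [exp1, exp2] at hp
    nlinarith
  have hpos := Finset.sum_pos' (fun i _ => hle i) ⟨i0, Finset.mem_univ _, hlt⟩
  simp only [mul_add, Finset.sum_add_distrib, s1, s2, add_zero, lt_irrefl] at hpos

/-- The potential whose critical points are the conformal barycenters. -/
def barycenterPotential (r : Fin n → ℝ) (x : Fin n → Vec d) (w : Vec d) : ℝ :=
  ∑ i, r i * (Real.log (‖x i - w‖ ^ 2) - Real.log (1 - ‖w‖ ^ 2))

theorem hasDerivAt_barycenterPotential {r : Fin n → ℝ} {x : Fin n → Vec d} (hx : x ∈ Arm d n)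
    {w : Vec d} (hw : w ∈ unitBall d) (u : Vec d) :
    HasDerivAt (fun t : ℝ => barycenterPotential r x (w + t • u))
      (-(2 / (1 - ‖w‖ ^ 2)) * inner ℝ (∑ i, r i • shift w (x i)) u) 0 := by
  have hq := sub_pos.2 (norm_sq_lt_one hw)
  have hid := hasDerivAt_id (0 : ℝ)
  have hsq : ∀ a : Vec d, HasDerivAt (fun t : ℝ => ‖a + t • u‖ ^ 2) (2 * inner ℝ a u) 0 := by
    intro a
    have h1 := ((hid.const_mul (2 * inner ℝ a u)).const_add (‖a‖ ^ 2)).fun_add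
      ((hid.fun_pow 2).const_mul (‖u‖ ^ 2))
    refine (h1.congr_deriv (by simp)).congr_of_eventuallyEq (Eventually.of_forall fun t => ?_)
    have := norm_sq_lincomb 1 t a u
    rw [one_smul] at this
    simp only [this, id]
    ring
  unfold barycenterPotential
  have hterm : ∀ i ∈ Finset.univ, HasDerivAt (fun t : ℝ => r i *
      (Real.log (‖x i - (w + t • u)‖ ^ 2) - Real.log (1 - ‖w + t • u‖ ^ 2)))
      (r i * (-(2 * inner ℝ (x i - w) u) / ‖x i - w‖ ^ 2 - -(2 * inner ℝ w u) / (1 - ‖w‖ ^ 2)))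
      0 := by
    intro i _
    have h0 := sub_ne_zero_of_unit hw (hx i)
    have h1 : HasDerivAt (fun t : ℝ => ‖x i - (w + t • u)‖ ^ 2) (-(2 * inner ℝ (x i - w) u)) 0 := by
      have := hsq (w - x i)
      refine (this.congr_deriv ?_).congr_of_eventuallyEq (Eventually.of_forall fun t => ?_)
      · rw [← neg_sub (x i) w, inner_neg_left]; ring
      · simp only
        rw [norm_sub_rev]
        congr 2
        abel
    have h2 := (hsq w).const_sub 1
    have h3 := h1.log (by simpa using h0.ne')
    have h4 := h2.log (by simpa using hq.ne')
    simpa using (h3.sub h4).const_mul (r i)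
  refine (HasDerivAt.fun_sum hterm).congr_deriv ?_
  rw [sum_inner, Finset.mul_sum]
  refine Finset.sum_congr rfl fun i _ => ?_
  have h0 := sub_ne_zero_of_unit hw (hx i)
  rw [shift_eq_of_unit hw (hx i), real_inner_smul_left, inner_sub_left (_ • _) w,
    real_inner_smul_left]
  field_simp
  ring

/-- When the xᵢ are 2δ-separated, at most one xⱼ lies closer than δ to w. With ε = 1-|w| and R = ∑
rᵢ, its term is bounded below by a positive multiple of log ε, the others by multiples of -log ε. In
total the lower bound is -K - (R - 2rⱼ) log ε, which is large as R > 2rⱼ. -/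
theorem barycenterPotential_pos_near_sphere (hn : 3 ≤ n) {r : Fin n → ℝ} (hr : ∀ i, 0 < r i)
    (hr2 : ∀ j, r j < (1 / 2) * ∑ i, r i) {x : Fin n → Vec d} (hx : x ∈ ArmX d n) :
    ∃ ρ : ℝ, 0 ≤ ρ ∧ ρ < 1 ∧ ∀ w ∈ unitBall d, ρ ≤ ‖w‖ → 0 < barycenterPotential r x w := by
  have : Nonempty (Fin n) := ⟨⟨0, by omega⟩⟩
  obtain ⟨δ, hδ0, hδ1, hδ⟩ : ∃ δ : ℝ, 0 < δ ∧ δ < 1 ∧ ∀ i j, i ≠ j → 2 * δ ≤ ‖x i - x j‖ := by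
    have h1 : ∀ p : Fin n × Fin n, ∃ e : ℝ, 0 < e ∧ (p.1 ≠ p.2 → 2 * e ≤ ‖x p.1 - x p.2‖) := by
      intro p
      by_cases hp : p.1 = p.2
      · exact ⟨1, one_pos, fun h => absurd hp h⟩
      · have := norm_pos_iff.2 (sub_ne_zero.2 (hx.2 _ _ hp))
        exact ⟨‖x p.1 - x p.2‖ / 2, by linarith, fun _ => by linarith⟩
    choose e he1 he2 using h1
    obtain ⟨p, hp⟩ := Finite.exists_min e
    refine ⟨min (e p) (1 / 2), lt_min (he1 p) (by norm_num),
      (min_le_right _ _).trans_lt (by norm_num), fun i j hij => ?_⟩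
    have := he2 (i, j) hij
    have := hp (i, j)
    have := min_le_left (e p) (1 / 2)
    linarith
  set R := ∑ i, r i with hR
  have hRpos : 0 < R := Finset.sum_pos (fun i _ => hr i) Finset.univ_nonempty
  obtain ⟨j0, hj0⟩ := Finite.exists_max r
  set η := R - 2 * r j0 with hη
  have hηpos : 0 < η := by have := hr2 j0; rw [hη]; linarith
  set K := R * (Real.log 2 - 2 * Real.log δ) with hK
  have hlogδ : Real.log δ < 0 := Real.log_neg hδ0 hδ1
  have hlog2 : 0 < Real.log 2 := Real.log_pos (by norm_num)
  have hKpos : 0 < K := mul_pos hRpos (by linarith)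
  -- The radius is chosen so that η log ε ≤ -(K+1), which makes the lower bound at least 1.
  refine ⟨1 - Real.exp (-(K + 1) / η), ?_, by linarith [Real.exp_pos (-(K + 1) / η)], ?_⟩
  · have : Real.exp (-(K + 1) / η) ≤ 1 :=
      Real.exp_le_one_iff.2 (div_nonpos_of_nonpos_of_nonneg (by linarith) hηpos.le)
    linarith
  intro w hw hρ
  have hw1 := mem_unitBall_iff.1 hw
  set ε := 1 - ‖w‖ with hε
  have hεpos : 0 < ε := by linarith
  have hεle : ε ≤ Real.exp (-(K + 1) / η) := by linarith
  have hlogε : η * Real.log ε ≤ -(K + 1) := by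
    have := (Real.log_le_log hεpos hεle)
    rw [Real.log_exp, le_div_iff₀ hηpos] at this
    linarith
  have hlogε0 : Real.log ε < 0 := by
    by_contra! h
    nlinarith
  have hq : 0 < 1 - ‖w‖ ^ 2 := sub_pos.2 (norm_sq_lt_one hw)
  have hlogq : Real.log (1 - ‖w‖ ^ 2) ≤ Real.log 2 + Real.log ε := by
    rw [← Real.log_mul two_ne_zero hεpos.ne']
    exact Real.log_le_log hq (by nlinarith [norm_nonneg w])
  have hnear : ∀ i, ε ≤ ‖x i - w‖ := by
    intro i
    have := norm_sub_norm_le (x i) w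
    rw [hx.1 i] at this
    exact this
  -- If no xᵢ is closer than δ, any index serves as the exceptional one.
  obtain ⟨j, hj⟩ : ∃ j, ∀ i, i ≠ j → δ ≤ ‖x i - w‖ := by
    by_cases hall : ∀ i, δ ≤ ‖x i - w‖
    · exact ⟨j0, fun i _ => hall i⟩
    · push Not at hall
      obtain ⟨j, hj⟩ := hall
      refine ⟨j, fun i hij => ?_⟩
      have h1 := hδ i j hij
      have h2 : ‖x i - x j‖ ≤ ‖x i - w‖ + ‖x j - w‖ := by
        rw [norm_sub_rev (x j) w]
        simpa using norm_add_le (x i - w) (w - x j)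
      linarith
  -- For i = j the true bound has no log δ term. The negative quantity 2 rⱼ log δ is added so that
  -- all indices share one expression and the sum factors through R.
  have hterm : ∀ i, r i * (2 * Real.log δ - Real.log 2 - Real.log ε) +
      (if i = j then 2 * r j * Real.log ε else 0) ≤
      r i * (Real.log (‖x i - w‖ ^ 2) - Real.log (1 - ‖w‖ ^ 2)) := by
    intro i
    have hlog : ∀ c : ℝ, 0 < c → c ≤ ‖x i - w‖ → 2 * Real.log c ≤ Real.log (‖x i - w‖ ^ 2) := by
      intro c hc0 hc
      rw [Real.log_pow]
      have := Real.log_le_log hc0 hc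
      push_cast
      linarith
    by_cases hij : i = j
    · subst hij
      have h1 := hlog ε hεpos (hnear i)
      have h2 := hr i
      rw [if_pos rfl]
      nlinarith
    · have h1 := hlog δ hδ0 (hj i hij)
      rw [if_neg hij, add_zero]
      exact mul_le_mul_of_nonneg_left (by linarith) (hr i).le
  have hsum := Finset.sum_le_sum fun i (_ : i ∈ Finset.univ) => hterm i
  rw [Finset.sum_add_distrib, ← Finset.sum_mul, Finset.sum_ite_eq' Finset.univ j,
    if_pos (Finset.mem_univ j), ← hR] at hsum
  have hjj := hj0 j
  have : 0 < R * (2 * Real.log δ - Real.log 2 - Real.log ε) + 2 * r j * Real.log ε := by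
    have h1 : 2 * r j0 * Real.log ε ≤ 2 * r j * Real.log ε := by nlinarith
    have h2 : R * (2 * Real.log δ - Real.log 2 - Real.log ε) + 2 * r j0 * Real.log ε =
        -K - η * Real.log ε := by rw [hK, hη]; ring
    linarith
  exact this.trans_le hsum

/-- The minimum over the closed ball of radius ρ is at most the value 0 at the centre, so it is not
attained where ‖w‖ = ρ; at an interior minimum all directional derivatives vanish. -/
theorem exists_barycenter (hn : 3 ≤ n) {r : Fin n → ℝ} (hr : ∀ i, 0 < r i)
    (hr2 : ∀ j, r j < (1 / 2) * ∑ i, r i) {x : Fin n → Vec d} (hx : x ∈ ArmX d n) :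
    ∃ w ∈ unitBall d, ∑ i, r i • shift w (x i) = 0 := by
  obtain ⟨ρ, hρ0, hρ1, hρ⟩ := barycenterPotential_pos_near_sphere hn hr hr2 hx
  have hball : ∀ w ∈ Metric.closedBall (0 : Vec d) ρ, w ∈ unitBall d := fun w hw => by
    rw [mem_unitBall_iff]; exact (mem_closedBall_zero_iff.1 hw).trans_lt hρ1
  have hcont : ContinuousOn (barycenterPotential r x) (Metric.closedBall 0 ρ) := by
    intro w hw
    apply ContinuousAt.continuousWithinAt
    have h1 := (sub_pos.2 (norm_sq_lt_one (hball w hw))).ne'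
    have h2 := fun i => (sub_ne_zero_of_unit (hball w hw) (hx.1 i)).ne'
    unfold barycenterPotential
    refine tendsto_finsetSum _ fun i _ => ?_
    exact continuousAt_const.mul (((by fun_prop : ContinuousAt (fun w => ‖x i - w‖ ^ 2) w).log
      (h2 i)).sub ((by fun_prop : ContinuousAt (fun w : Vec d => 1 - ‖w‖ ^ 2) w).log h1))
  obtain ⟨w, hw, hmin⟩ := (isCompact_closedBall (0 : Vec d) ρ).exists_isMinOn
    ⟨0, by simpa using hρ0⟩ hcont
  have hwb := hball w hw
  have hlt : ‖w‖ < ρ := by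
    by_contra! h
    have h1 := hρ w hwb h
    have h2 : barycenterPotential r x w ≤ barycenterPotential r x 0 := hmin (by simpa using hρ0)
    have h3 : barycenterPotential r x 0 = 0 := by
      simp [barycenterPotential, hx.1 _]
    linarith
  refine ⟨w, hwb, ?_⟩
  have hq := sub_pos.2 (norm_sq_lt_one hwb)
  have hcrit : ∀ u, inner ℝ (∑ i, r i • shift w (x i)) u = 0 := by
    intro u
    have hloc : IsLocalMin (fun t : ℝ => barycenterPotential r x (w + t • u)) 0 := by
      have hc : ContinuousAt (fun t : ℝ => ‖w + t • u‖) 0 := by fun_prop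
      have : ∀ᶠ t in 𝓝 (0 : ℝ), ‖w + t • u‖ < ρ := hc.eventually_lt_const (by simpa using hlt)
      filter_upwards [this] with t ht
      simp only [zero_smul, add_zero]
      exact hmin (mem_closedBall_zero_iff.2 ht.le)
    have := hloc.hasDerivAt_eq_zero (hasDerivAt_barycenterPotential hx.1 hwb u)
    exact (mul_eq_zero.1 this).resolve_left (neg_ne_zero.2 (by positivity))
  exact inner_self_eq_zero.1 (hcrit _)

theorem existsUnique_isConformalBarycenter (hn : 3 ≤ n) {r : Fin n → ℝ} (hr : ∀ i, 0 < r i)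
    (hr2 : ∀ j, r j < (1 / 2) * ∑ i, r i) {x : Fin n → Vec d} (hx : x ∈ ArmX d n) :
    ∃! w, IsConformalBarycenter r x w := by
  simp only [isConformalBarycenter_iff hx.1]
  obtain ⟨w, hw, h⟩ := exists_barycenter hn hr hr2 hx
  exact ⟨w, ⟨hw, h⟩, fun w' h' => barycenter_unique hn hr hx h'.1 hw h'.2 h⟩

theorem conformalBarycenter_spec (hn : 3 ≤ n) {r : Fin n → ℝ} (hr : ∀ i, 0 < r i)
    (hr2 : ∀ j, r j < (1 / 2) * ∑ i, r i) {x : Fin n → Vec d} (hx : x ∈ ArmX d n) :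
    conformalBarycenter r x ∈ unitBall d ∧
      ∑ i, r i • shift (conformalBarycenter r x) (x i) = 0 := by
  have h := (existsUnique_isConformalBarycenter hn hr hr2 hx).exists
  rw [← isConformalBarycenter_iff hx.1, conformalBarycenter, dif_pos h]
  exact h.choose_spec

theorem conformalBarycenter_eq (hn : 3 ≤ n) {r : Fin n → ℝ} (hr : ∀ i, 0 < r i)
    (hr2 : ∀ j, r j < (1 / 2) * ∑ i, r i) {x : Fin n → Vec d} (hx : x ∈ ArmX d n) {w : Vec d}
    (hw : w ∈ unitBall d) (h : ∑ i, r i • shift w (x i) = 0) : conformalBarycenter r x = w :=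
  have hs := conformalBarycenter_spec hn hr hr2 hx
  barycenter_unique hn hr hx hs.1 hw hs.2 h

end Barycenter

/-! ### Sums of orthogonal projections -/

section ProjectionSum

variable {d n : ℕ}

/-- The operator `u ↦ ∑ cᵢ (u - ⟨yᵢ, u⟩ yᵢ)`. -/
def projOp (c : Fin n → ℝ) (y : Fin n → Vec d) : Vec d →ₗ[ℝ] Vec d :=
  ∑ i, c i • (LinearMap.id - (innerₛₗ ℝ (y i)).smulRight (y i))

theorem projOp_apply (c : Fin n → ℝ) (y : Fin n → Vec d) (u : Vec d) :
    projOp c y u = ∑ i, c i • (u - inner ℝ (y i) u • y i) := by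
  simp [projOp, LinearMap.sum_apply]

theorem inner_projOp_self (c : Fin n → ℝ) (y : Fin n → Vec d) (u : Vec d) :
    inner ℝ (projOp c y u) u = ∑ i, c i * (‖u‖ ^ 2 - inner ℝ (y i) u ^ 2) := by
  rw [projOp_apply, sum_inner]
  refine Finset.sum_congr rfl fun i _ => ?_
  rw [real_inner_smul_left, inner_sub_left, real_inner_smul_left, real_inner_self_eq_norm_sq]
  ring

theorem projOp_injective (hn : 3 ≤ n) {y : Fin n → Vec d} (hy : y ∈ ArmX d n)
    {c : Fin n → ℝ} (hc : ∀ i, 0 < c i) : Function.Injective (projOp c y) := by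
  rw [← LinearMap.ker_eq_bot, LinearMap.ker_eq_bot']
  intro u hu
  by_contra hne
  have h := sum_norm_sq_sub_inner_sq_pos hn hy hc hne
  rw [← inner_projOp_self, hu, inner_zero_left] at h
  exact lt_irrefl _ h

theorem projOp_surjective (hn : 3 ≤ n) {y : Fin n → Vec d} (hy : y ∈ ArmX d n)
    {c : Fin n → ℝ} (hc : ∀ i, 0 < c i) : Function.Surjective (projOp c y) :=
  LinearMap.injective_iff_surjective.1 (projOp_injective hn hy hc)

end ProjectionSum

/-! ### The shift map on the sphere as an inversion -/

section Inversion

open Filter Topology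

variable {d n : ℕ}

/-- The inversion formula for `shift (-w)` on the unit sphere. -/
def sphereShift (w z : Vec d) : Vec d := ((1 - ‖w‖ ^ 2) / ‖z + w‖ ^ 2) • (z + w) + w

/-- Agreement is needed only on the sphere: `sphereShift` serves as the ambient extension whose
derivatives are computed. -/
theorem sphereShift_eq {w z : Vec d} (hw : w ∈ unitBall d) (hz : ‖z‖ = 1) :
    sphereShift w z = shift (-w) z := by
  rw [shift_eq_of_unit (neg_mem_unitBall hw) hz, sphereShift, norm_neg, sub_neg_eq_add,
    sub_neg_eq_add]

theorem add_norm_sq_pos {w z : Vec d} (hw : w ∈ unitBall d) (hz : ‖z‖ = 1) :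
    0 < ‖z + w‖ ^ 2 := by
  simpa using sub_ne_zero_of_unit (neg_mem_unitBall hw) hz

theorem contDiffAt_sphereShift {m : WithTop ℕ∞} {p : Vec d × Vec d} (h : ‖p.2 + p.1‖ ^ 2 ≠ 0) :
    ContDiffAt ℝ m (fun p : Vec d × Vec d => sphereShift p.1 p.2) p := by
  unfold sphereShift
  have h1 : ContDiffAt ℝ m (fun p : Vec d × Vec d => 1 - ‖p.1‖ ^ 2) p :=
    contDiffAt_const.sub (contDiffAt_fst.norm_sq ℝ)
  have h2 : ContDiffAt ℝ m (fun p : Vec d × Vec d => p.2 + p.1) p :=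
    contDiffAt_snd.add contDiffAt_fst
  exact ((h1.div (h2.norm_sq ℝ) h).smul h2).add contDiffAt_fst

theorem hasDerivAt_norm_sq_line (a u : Vec d) :
    HasDerivAt (fun t : ℝ => ‖a + t • u‖ ^ 2) (2 * inner ℝ a u) 0 := by
  have h1 : HasDerivAt (fun t : ℝ => a + t • u) u 0 := by
    simpa using ((hasDerivAt_id (0 : ℝ)).smul_const u).const_add a
  simpa using h1.norm_sq

theorem hasDerivAt_sphereShift_line {w z : Vec d} (h : ‖z + w‖ ^ 2 ≠ 0) (u v : Vec d) :
    HasDerivAt (fun t : ℝ => sphereShift (w + t • u) (z + t • v))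
      (((1 - ‖w‖ ^ 2) / ‖z + w‖ ^ 2) • (v + u) -
        (2 * inner ℝ w u / ‖z + w‖ ^ 2 +
          (1 - ‖w‖ ^ 2) * (2 * inner ℝ (z + w) (v + u)) / (‖z + w‖ ^ 2) ^ 2) • (z + w) + u) 0 := by
  have h1 : ∀ a u : Vec d, HasDerivAt (fun t : ℝ => a + t • u) u 0 := fun a u => by
    simpa using ((hasDerivAt_id (0 : ℝ)).smul_const u).const_add a
  have hq := (hasDerivAt_norm_sq_line w u).const_sub 1
  have hD := hasDerivAt_norm_sq_line (z + w) (v + u)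
  have h2 := (((hq.fun_div hD (by simpa using h)).smul (h1 (z + w) (v + u))).fun_add (h1 w u))
  simp only [zero_smul, add_zero] at h2
  refine (h2.congr_deriv ?_).congr_of_eventuallyEq (Eventually.of_forall fun t => ?_)
  · have : (-(2 * inner ℝ w u) * ‖z + w‖ ^ 2 -
        (1 - ‖w‖ ^ 2) * (2 * inner ℝ (z + w) (v + u))) / (‖z + w‖ ^ 2) ^ 2 =
        -(2 * inner ℝ w u / ‖z + w‖ ^ 2 +
          (1 - ‖w‖ ^ 2) * (2 * inner ℝ (z + w) (v + u)) / (‖z + w‖ ^ 2) ^ 2) := by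
      field_simp
      ring
    rw [this]
    module
  · simp only [sphereShift]
    have : z + t • v + (w + t • u) = z + w + t • (v + u) := by module
    rw [this]
    rfl

theorem fderiv_sphereShift {w z : Vec d} (h : ‖z + w‖ ^ 2 ≠ 0) (u v : Vec d) :
    fderiv ℝ (fun p : Vec d × Vec d => sphereShift p.1 p.2) (w, z) (u, v) =
      ((1 - ‖w‖ ^ 2) / ‖z + w‖ ^ 2) • (v + u) -
        (2 * inner ℝ w u / ‖z + w‖ ^ 2 +
          (1 - ‖w‖ ^ 2) * (2 * inner ℝ (z + w) (v + u)) / (‖z + w‖ ^ 2) ^ 2) • (z + w) + u := by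
  have hf := ((contDiffAt_sphereShift (m := 1) (p := (w, z)) h).differentiableAt
    one_ne_zero).hasFDerivAt
  have hl : HasDerivAt (fun t : ℝ => (w, z) + t • (u, v)) (u, v) 0 := by
    simpa using ((hasDerivAt_id (0 : ℝ)).smul_const (u, v)).const_add (w, z)
  have := hf.comp_hasDerivAt_of_eq (0 : ℝ) hl (by simp)
  exact this.unique (hasDerivAt_sphereShift_line h u v)

theorem inner_add_eq {w z : Vec d} (hz : ‖z‖ = 1) :
    inner ℝ (z + w) w = (‖z + w‖ ^ 2 - (1 - ‖w‖ ^ 2)) / 2 := by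
  rw [norm_add_sq_real, hz, inner_add_left, real_inner_self_eq_norm_sq]
  ring

/-- The derivative of the shift map with respect to its centre, expressed through its value. -/
theorem fderiv_sphereShift_left {w z : Vec d} (hw : w ∈ unitBall d) (hz : ‖z‖ = 1) (u : Vec d) :
    fderiv ℝ (fun p : Vec d × Vec d => sphereShift p.1 p.2) (w, z) (u, 0) =
      (2 / (1 - ‖w‖ ^ 2)) • ((u - inner ℝ (sphereShift w z) u • sphereShift w z) -
        (inner ℝ w (sphereShift w z) • u - inner ℝ u (sphereShift w z) • w)) := by
  have h := (add_norm_sq_pos hw hz).ne'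
  have hq := (sub_pos.2 (norm_sq_lt_one hw)).ne'
  rw [fderiv_sphereShift h]
  have h1 : inner ℝ u (sphereShift w z) =
      (1 - ‖w‖ ^ 2) / ‖z + w‖ ^ 2 * inner ℝ (z + w) u + inner ℝ w u := by
    rw [sphereShift, inner_add_right, real_inner_smul_right, real_inner_comm, real_inner_comm w u]
  have h2 : inner ℝ w (sphereShift w z) =
      (1 - ‖w‖ ^ 2) / ‖z + w‖ ^ 2 * ((‖z + w‖ ^ 2 - (1 - ‖w‖ ^ 2)) / 2) + ‖w‖ ^ 2 := by
    rw [sphereShift, inner_add_right, real_inner_smul_right, real_inner_comm, inner_add_eq hz,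
      real_inner_self_eq_norm_sq]
  rw [real_inner_comm u (sphereShift w z), h1, h2, sphereShift, zero_add]
  -- Both sides are now combinations of u, w and e, and it suffices to compare their scalar
  -- coefficients.
  generalize z + w = e at *
  generalize ‖e‖ ^ 2 = D at *
  generalize inner ℝ e u = a
  generalize inner ℝ w u = b
  generalize ‖w‖ ^ 2 = W at *
  match_scalars <;> field_simp <;> ring

/-- The derivative of the shift map in directions tangent to the sphere is a reflection, up to a
conformal factor, applied to a simple expression. -/
theorem fderiv_sphereShift_tangent {w y : Vec d} (hw : w ∈ unitBall d) (hy : ‖y‖ = 1)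
    {u v : Vec d} (hv : inner ℝ y v = 0) :
    ∃ x : Vec d, x = v + (2 / (1 - ‖w‖ ^ 2)) • ((u - inner ℝ y u • y) +
        (inner ℝ y w • u - inner ℝ y u • w)) ∧
    fderiv ℝ (fun p : Vec d × Vec d => sphereShift p.1 p.2) (w, y) (u, v) =
      ((1 - ‖w‖ ^ 2) / ‖y + w‖ ^ 2) • (x - (2 * inner ℝ (y + w) x / ‖y + w‖ ^ 2) • (y + w)) := by
  refine ⟨_, rfl, ?_⟩
  have h := (add_norm_sq_pos hw hy).ne'
  have hq := (sub_pos.2 (norm_sq_lt_one hw)).ne'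
  rw [fderiv_sphereShift h]
  have hD : ‖y + w‖ ^ 2 = 1 + 2 * inner ℝ y w + ‖w‖ ^ 2 := by
    rw [norm_add_sq_real, hy]; ring
  simp only [inner_add_left, inner_add_right, inner_sub_right, inner_smul_right,
    real_inner_self_eq_norm_sq, hv, hy, real_inner_comm y w]
  rw [hD] at h ⊢
  generalize inner ℝ y w = c at *
  generalize inner ℝ y u = a at *
  generalize inner ℝ w u = b at *
  generalize inner ℝ w v = b' at *
  generalize ‖w‖ ^ 2 = W at *
  match_scalars <;> field_simp <;> ring

end Inversion

/-! ### Submanifolds -/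

section Submanifolds

open Filter Topology

/-- A criterion with a defining function that takes values in any finite dimensional space. -/
theorem IsSmoothSubmanifold.of_regular {E F : Type*} [NormedAddCommGroup E] [NormedSpace ℝ E]
    [NormedAddCommGroup F] [NormedSpace ℝ F] [FiniteDimensional ℝ F] {M U : Set E} {k : ℕ}
    (hk : k + Module.finrank ℝ F = Module.finrank ℝ E) (hU : IsOpen U) (Φ : E → F)
    (hΦ : ContDiff ℝ ∞ Φ) (hM : M = {q ∈ U | Φ q = 0})
    (hs : ∀ q ∈ M, Function.Surjective (fderiv ℝ Φ q)) : IsSmoothSubmanifold M k := by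
  let e : F ≃L[ℝ] EuclideanSpace ℝ (Fin (Module.finrank ℝ F)) :=
    ContinuousLinearEquiv.ofFinrankEq (by simp)
  refine ⟨Module.finrank ℝ F, hk, fun p hp => ⟨U, hU, ?_, fun q => e (Φ q), ?_, ?_, ?_⟩⟩
  · rw [hM] at hp; exact hp.1
  · exact (e.contDiff.comp hΦ).contDiffOn
  · rw [hM]
    ext q
    simp only [Set.mem_inter_iff, Set.mem_ofPred_eq, map_eq_zero_iff e e.injective]
    tauto
  · intro q hq
    have h1 : HasFDerivAt (fun q => e (Φ q)) ((e : F →L[ℝ] EuclideanSpace ℝ (Fin (Module.finrank ℝ F))).comp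
        (fderiv ℝ Φ q)) q :=
      e.hasFDerivAt.comp q (hΦ.differentiable (by simp) q).hasFDerivAt
    rw [h1.fderiv]
    exact e.surjective.comp (hs q hq.1)

variable {d n : ℕ}

theorem finrank_configurations : Module.finrank ℝ (Fin n → Vec d) = n * d := by
  rw [Module.finrank_pi_fintype]
  simp

theorem isOpen_distinct : IsOpen {x : Fin n → Vec d | ∀ i j, i ≠ j → x i ≠ x j} := by
  simp only [Set.ofPred_forall]
  refine isOpen_iInter_of_finite fun i => isOpen_iInter_of_finite fun j =>
    isOpen_iInter_of_finite fun _ => ?_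
  exact isOpen_ne_fun (continuous_apply i) (continuous_apply j)

theorem fderiv_norm_sq_pi (x v : Fin n → Vec d) :
    fderiv ℝ (fun x : Fin n → Vec d => fun i => ‖x i‖ ^ 2 - 1) x v =
      fun i => 2 * inner ℝ (x i) (v i) := by
  have h : HasFDerivAt (fun x : Fin n → Vec d => fun i => ‖x i‖ ^ 2 - 1)
      (ContinuousLinearMap.pi fun i => (2 • innerSL ℝ (x i)).comp
        (ContinuousLinearMap.proj (R := ℝ) (φ := fun _ : Fin n => Vec d) i)) x := by
    rw [hasFDerivAt_pi]
    intro i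
    exact ((ContinuousLinearMap.proj (R := ℝ) (φ := fun _ : Fin n => Vec d)
      i).hasFDerivAt.norm_sq).sub_const 1
  rw [h.fderiv]
  ext i
  simp

theorem contDiff_norm_sq_pi {m : WithTop ℕ∞} :
    ContDiff ℝ m (fun x : Fin n → Vec d => fun i => ‖x i‖ ^ 2 - 1) :=
  contDiff_pi.2 fun i => ((contDiff_apply ℝ (Vec d) i).norm_sq ℝ).sub contDiff_const

theorem norm_sq_sub_one_eq_zero {z : Vec d} : ‖z‖ ^ 2 - 1 = 0 ↔ ‖z‖ = 1 := by
  rw [sub_eq_zero, pow_eq_one_iff_of_nonneg (norm_nonneg _) two_ne_zero]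

theorem isSmoothSubmanifold_ArmX (hd : 2 ≤ d) : IsSmoothSubmanifold (ArmX d n) (n * (d - 1)) := by
  refine IsSmoothSubmanifold.of_regular ?_ isOpen_distinct
    (fun x : Fin n → Vec d => fun i => ‖x i‖ ^ 2 - 1) contDiff_norm_sq_pi ?_ ?_
  · rw [finrank_configurations]
    obtain ⟨e, rfl⟩ := Nat.exists_eq_add_of_le hd
    rw [show 2 + e - 1 = 1 + e by omega]
    simp
    ring
  · ext x
    simp only [ArmX, Arm, Set.mem_ofPred_eq, funext_iff, Pi.zero_apply, norm_sq_sub_one_eq_zero]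
    tauto
  · intro x hx a
    -- Radial variations alone change the norms: 2⟨xᵢ, (aᵢ/2) xᵢ⟩ = aᵢ.
    refine ⟨fun i => (a i / 2) • x i, ?_⟩
    rw [fderiv_norm_sq_pi]
    ext i
    simp only [inner_smul_right, real_inner_self_eq_norm_sq, hx.1 i]
    ring

/-- The unit-length and closing constraints are independent because ∑ rᵢ(I - yᵢyᵢᵀ) is onto ℝᵈ. -/
theorem isSmoothSubmanifold_ball_PolX (hd : 2 ≤ d) (hn : 3 ≤ n) {r : Fin n → ℝ}
    (hr : ∀ i, 0 < r i) :
    IsSmoothSubmanifold (unitBall d ×ˢ PolX d r) (n * (d - 1)) := by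
  let L : (Fin n → Vec d) →L[ℝ] Vec d := ∑ i, r i • ContinuousLinearMap.proj i
  have hL : ∀ v, L v = ∑ i, r i • v i := fun v => by simp [L]
  refine IsSmoothSubmanifold.of_regular ?_ ((Metric.isOpen_ball (x := (0 : Vec d)) (ε := 1)).prod
    (isOpen_distinct (n := n)))
    (fun p : Vec d × (Fin n → Vec d) => ((fun i => ‖p.2 i‖ ^ 2 - 1 : Fin n → ℝ), L p.2)) ?_ ?_ ?_
  · rw [Module.finrank_prod, Module.finrank_prod, finrank_configurations]
    obtain ⟨e, rfl⟩ := Nat.exists_eq_add_of_le hd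
    rw [show 2 + e - 1 = 1 + e by omega]
    simp
    ring
  · exact (contDiff_norm_sq_pi.comp contDiff_snd).prodMk (L.contDiff.comp contDiff_snd)
  · ext p
    simp only [PolX, Pol, ArmX, Arm, Set.mem_ofPred_eq, Set.mem_prod, Set.mem_inter_iff,
      Prod.mk_eq_zero, funext_iff, Pi.zero_apply, norm_sq_sub_one_eq_zero, hL, unitBall]
    tauto
  · rintro ⟨w, y⟩ ⟨-, hy, hyX⟩ ⟨a, b⟩
    -- The radial part of the variation realises `a`. The tangential part, the projection of one
    -- vector u, leaves the norms unchanged and corrects the closing sum to `b`.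
    obtain ⟨u, hu⟩ := projOp_surjective hn hyX hr (b - ∑ i, r i • (a i / 2) • y i)
    rw [projOp_apply] at hu
    refine ⟨(0, fun i => (a i / 2) • y i + (u - inner ℝ (y i) u • y i)), ?_⟩
    have h1 : HasFDerivAt (fun p : Vec d × (Fin n → Vec d) => (fun i => ‖p.2 i‖ ^ 2 - 1 : Fin n → ℝ))
        ((fderiv ℝ (fun x : Fin n → Vec d => fun i => ‖x i‖ ^ 2 - 1) y).comp
          (ContinuousLinearMap.snd ℝ _ _)) (w, y) :=
      HasFDerivAt.comp (g := fun x : Fin n → Vec d => fun i => ‖x i‖ ^ 2 - 1) (f := Prod.snd) (w, y)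
        ((contDiff_norm_sq_pi (m := 1)).differentiable one_ne_zero y).hasFDerivAt hasFDerivAt_snd
    have h2 : HasFDerivAt (fun p : Vec d × (Fin n → Vec d) => L p.2)
        (L.comp (ContinuousLinearMap.snd ℝ _ _)) (w, y) :=
      HasFDerivAt.comp (g := L) (f := Prod.snd) (w, y) L.hasFDerivAt hasFDerivAt_snd
    rw [(h1.prodMk h2).fderiv]
    simp only [ContinuousLinearMap.prod_apply, ContinuousLinearMap.comp_apply,
      ContinuousLinearMap.coe_snd', fderiv_norm_sq_pi, hL, smul_add, Finset.sum_add_distrib, hu]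
    refine Prod.ext (funext fun i => ?_) (by simp)
    simp only [inner_add_right, inner_sub_right, inner_smul_right, real_inner_self_eq_norm_sq,
      hyX.1 i]
    ring

end Submanifolds

/-! ### The closure map is smooth -/

section Closure

open Filter Topology

variable {d n : ℕ}

/-- The equation of the conformal barycenter, extended smoothly from the sphere. -/
def barycenterEq (r : Fin n → ℝ) (p : (Fin n → Vec d) × Vec d) : Vec d :=
  ∑ i, r i • sphereShift (-p.2) (p.1 i)

theorem barycenterEq_of_mem (r : Fin n → ℝ) {x : Fin n → Vec d} (hx : x ∈ Arm d n) {w : Vec d}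
    (hw : w ∈ unitBall d) : barycenterEq r (x, w) = ∑ i, r i • shift w (x i) := by
  refine Finset.sum_congr rfl fun i _ => ?_
  rw [sphereShift_eq (neg_mem_unitBall hw) (hx i), neg_neg]

/-- The linear map `(v, u) ↦ (-u, v i)`. -/
def negSndProj (d : ℕ) {n : ℕ} (i : Fin n) : (Fin n → Vec d) × Vec d →L[ℝ] Vec d × Vec d :=
  (-(ContinuousLinearMap.snd ℝ (Fin n → Vec d) (Vec d))).prod
    ((ContinuousLinearMap.proj (R := ℝ) (φ := fun _ : Fin n => Vec d) i).comp
      (ContinuousLinearMap.fst ℝ (Fin n → Vec d) (Vec d)))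

theorem contDiffAt_sphereShift_negSndProj {m : WithTop ℕ∞} {x : Fin n → Vec d} (hx : x ∈ Arm d n)
    {w : Vec d} (hw : w ∈ unitBall d) (i : Fin n) :
    ContDiffAt ℝ m (fun p : (Fin n → Vec d) × Vec d => sphereShift (-p.2) (p.1 i)) (x, w) := by
  have h := (add_norm_sq_pos (neg_mem_unitBall hw) (hx i)).ne'
  exact (contDiffAt_sphereShift (p := negSndProj d i (x, w)) h).comp (x, w)
    (negSndProj d i).contDiff.contDiffAt

theorem contDiffAt_barycenterEq {m : WithTop ℕ∞} (r : Fin n → ℝ) {x : Fin n → Vec d}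
    (hx : x ∈ Arm d n) {w : Vec d} (hw : w ∈ unitBall d) :
    ContDiffAt ℝ m (barycenterEq r) (x, w) :=
  ContDiffAt.sum fun i _ => ContDiffAt.const_smul (r i) (contDiffAt_sphereShift_negSndProj hx hw i)

theorem fderiv_barycenterEq (r : Fin n → ℝ) {x : Fin n → Vec d}
    (hx : x ∈ Arm d n) {w : Vec d} (hw : w ∈ unitBall d) (v : Fin n → Vec d) (u : Vec d) :
    fderiv ℝ (barycenterEq r) (x, w) (v, u) =
      ∑ i, r i • fderiv ℝ (fun p : Vec d × Vec d => sphereShift p.1 p.2) (-w, x i) (-u, v i) := by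
  have hterm : ∀ i ∈ Finset.univ, HasFDerivAt
      (fun p : (Fin n → Vec d) × Vec d => r i • sphereShift (-p.2) (p.1 i))
      (r i • (fderiv ℝ (fun p : Vec d × Vec d => sphereShift p.1 p.2) (-w, x i)).comp
        (negSndProj d i)) (x, w) := by
    intro i _
    have h := (add_norm_sq_pos (neg_mem_unitBall hw) (hx i)).ne'
    have h1 := ((contDiffAt_sphereShift (m := 1) (p := negSndProj d i (x, w)) h).differentiableAt
      one_ne_zero).hasFDerivAt
    exact (h1.comp (x, w) (negSndProj d i).hasFDerivAt).const_smul (r i)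
  have h2 : HasFDerivAt (barycenterEq r) _ (x, w) := HasFDerivAt.fun_sum hterm
  rw [h2.fderiv]
  simp [negSndProj]

/-- In `fderiv_sphereShift_left` the terms beyond the projection are linear in σ(w,xᵢ), so their
weighted sum vanishes at a barycenter. -/
theorem fderiv_barycenterEq_inr (r : Fin n → ℝ) {x : Fin n → Vec d}
    (hx : x ∈ Arm d n) {w : Vec d} (hw : w ∈ unitBall d) (h : ∑ i, r i • shift w (x i) = 0)
    (u : Vec d) : fderiv ℝ (barycenterEq r) (x, w) (0, u) =
      -(2 / (1 - ‖w‖ ^ 2)) • projOp r (fun i => shift w (x i)) u := by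
  have hinner : ∀ a : Vec d, ∑ i, r i * inner ℝ a (shift w (x i)) = 0 := fun a => by
    have : inner ℝ a (∑ i, r i • shift w (x i)) = 0 := by rw [h, inner_zero_right]
    simpa only [inner_sum, inner_smul_right] using this
  rw [fderiv_barycenterEq r hx hw, projOp_apply]
  have hterm : ∀ i, r i • fderiv ℝ (fun p : Vec d × Vec d => sphereShift p.1 p.2) (-w, x i)
      (-u, (0 : Fin n → Vec d) i) =
      -(2 / (1 - ‖w‖ ^ 2)) • (r i • (u - inner ℝ (shift w (x i)) u • shift w (x i))) +
      -(2 / (1 - ‖w‖ ^ 2)) • ((r i * inner ℝ w (shift w (x i))) • u -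
        (r i * inner ℝ u (shift w (x i))) • w) := by
    intro i
    rw [Pi.zero_apply, fderiv_sphereShift_left (neg_mem_unitBall hw) (hx i),
      sphereShift_eq (neg_mem_unitBall hw) (hx i), neg_neg, norm_neg, inner_neg_left,
      inner_neg_left, inner_neg_right]
    module
  rw [Finset.sum_congr rfl fun i _ => hterm i, Finset.sum_add_distrib, ← Finset.smul_sum,
    ← Finset.smul_sum, Finset.sum_sub_distrib, ← Finset.sum_smul, ← Finset.sum_smul, hinner w,
    hinner u]
  simp

/-- Near a configuration with a known barycenter, the barycenter is given by an analytic map. -/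
theorem exists_local_barycenter (hn : 3 ≤ n) {r : Fin n → ℝ} (hr : ∀ i, 0 < r i)
    {x : Fin n → Vec d} (hx : x ∈ ArmX d n) {w : Vec d} (hw : w ∈ unitBall d)
    (h : ∑ i, r i • shift w (x i) = 0) :
    ∃ β : (Fin n → Vec d) → Vec d, ContDiffAt ℝ ω β x ∧ β x = w ∧
      (∀ᶠ z in 𝓝 x, barycenterEq r (z, β z) = 0) ∧
      ∀ v, fderiv ℝ (barycenterEq r) (x, w) (v, 0) = 0 → fderiv ℝ β x v = 0 := by
  have hc : ContDiffAt ℝ ω (barycenterEq r) (x, w) := contDiffAt_barycenterEq r hx.1 hw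
  set A := (fderiv ℝ (barycenterEq r) (x, w)).comp (ContinuousLinearMap.inr ℝ (Fin n → Vec d) (Vec d))
    with hA
  have hq : -(2 / (1 - ‖w‖ ^ 2)) ≠ 0 :=
    neg_ne_zero.2 (div_ne_zero two_ne_zero (sub_pos.2 (norm_sq_lt_one hw)).ne')
  have hAinj : Function.Injective A := by
    intro a b hab
    simp only [hA, ContinuousLinearMap.comp_apply, ContinuousLinearMap.inr_apply,
      fderiv_barycenterEq_inr r hx.1 hw h] at hab
    exact projOp_injective hn (shift_mem_ArmX hw hx) hr (smul_right_injective _ hq hab)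
  have hAinv : A.IsInvertible :=
    ⟨(LinearEquiv.ofInjectiveEndo (A : Vec d →ₗ[ℝ] Vec d) hAinj).toContinuousLinearEquiv, by
      ext; rfl⟩
  have h0 : barycenterEq r (x, w) = 0 := by rw [barycenterEq_of_mem r hx.1 hw, h]
  refine ⟨hc.implicitFunction (by simp) hAinv, hc.contDiffAt_implicitFunction (by simp) hAinv,
    hc.implicitFunction_apply_self (by simp) hAinv, ?_, fun v hv => ?_⟩
  · simpa [h0] using hc.eventually_apply_implicitFunction (by simp) hAinv
  -- The derivative of the implicit function is -A⁻¹ composed with the partial derivative in x, so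
  -- it kills the kernel of the latter. Curves in `PolX` are built from this.
  · rw [(hc.hasStrictFDerivAt_implicitFunction (by simp) hAinv).hasFDerivAt.fderiv]
    simp [hv]

/-- Uniqueness of the barycenter forces the local analytic branch β to coincide with w_* at all
nearby configurations. -/
theorem smoothOnSubset_closureMap (hn : 3 ≤ n) {r : Fin n → ℝ} (hr : ∀ i, 0 < r i)
    (hr2 : ∀ j, r j < (1 / 2) * ∑ i, r i) : SmoothOnSubset (closureMap r) (ArmX d n) := by
  intro x hx
  obtain ⟨hw, h⟩ := conformalBarycenter_spec hn hr hr2 hx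
  obtain ⟨β, hβ, hβx, hβ0, -⟩ := exists_local_barycenter hn hr hx hw h
  have hg : ContDiffAt ℝ ω (fun z => (β z, fun i => sphereShift (-β z) (z i)) :
      (Fin n → Vec d) → Vec d × (Fin n → Vec d)) x := by
    refine hβ.prodMk (contDiffAt_pi.2 fun i => ?_)
    have h1 := contDiffAt_sphereShift_negSndProj (m := ω) hx.1 (hβx ▸ hw) i
    have h2 := h1.comp x (contDiffAt_id.prodMk hβ)
    exact h2
  have hball : ∀ᶠ z in 𝓝 x, β z ∈ unitBall d :=
    hβ.continuousAt.eventually_mem (Metric.isOpen_ball.mem_nhds (by rw [hβx]; exact hw))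
  obtain ⟨U, hU, hUo, hxU⟩ := eventually_nhds_iff.1
    ((hg.eventually (by simp)).and (hball.and hβ0))
  refine ⟨U, hUo, hxU, _, fun z hz => ((hU z hz).1.of_le le_top).contDiffWithinAt, ?_⟩
  rintro z ⟨hzX, hzU⟩
  obtain ⟨-, h2, h3⟩ := hU z hzU
  rw [barycenterEq_of_mem r hzX.1 h2] at h3
  have hb := conformalBarycenter_eq hn hr hr2 hzX h2 h3
  simp only [closureMap, hb]
  refine Prod.ext rfl (funext fun i => ?_)
  simp only
  rw [sphereShift_eq (neg_mem_unitBall h2) (hzX.1 i), neg_neg]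

theorem smoothOnSubset_opening (r : Fin n → ℝ) :
    SmoothOnSubset (opening (d := d) (n := n)) (unitBall d ×ˢ PolX d r) := by
  rintro ⟨w, y⟩ ⟨hw, hy⟩
  have hg : ContDiffAt ℝ ω (fun p : Vec d × (Fin n → Vec d) => fun i => sphereShift p.1 (p.2 i))
      (w, y) := by
    refine contDiffAt_pi.2 fun i => ?_
    have h1 := contDiffAt_sphereShift (m := ω) (p := (w, y i)) (add_norm_sq_pos hw (hy.2.1 i)).ne'
    have h2 : ContDiffAt ℝ ω (fun p : Vec d × (Fin n → Vec d) => (p.1, p.2 i)) (w, y) := by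
      fun_prop
    have h3 := ContDiffAt.comp (w, y) h1 h2
    exact h3
  obtain ⟨U, hU, hUo, hxU⟩ := eventually_nhds_iff.1 (hg.eventually (by simp))
  refine ⟨U, hUo, hxU, _, fun z hz => ((hU z hz).of_le le_top).contDiffWithinAt, ?_⟩
  rintro p ⟨⟨hp1, hp2⟩, -⟩
  exact funext fun i => sphereShift_eq hp1 (hp2.2.1 i)

/-- If y is closed, `w` solves the barycenter equation of `opening (w, y)`, so by uniqueness the
closure map recovers it. -/
theorem isDiffeomorphism_opening (hn : 3 ≤ n) {r : Fin n → ℝ} (hr : ∀ i, 0 < r i)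
    (hr2 : ∀ j, r j < (1 / 2) * ∑ i, r i) :
    IsDiffeomorphismWithInverse opening (closureMap r) (unitBall d ×ˢ PolX d r) (ArmX d n) where
  mapsTo := fun p hp => shift_mem_ArmX (neg_mem_unitBall hp.1) hp.2.2
  mapsTo_inv := fun x hx => by
    obtain ⟨hw, h⟩ := conformalBarycenter_spec hn hr hr2 hx
    have hX := shift_mem_ArmX hw hx
    exact ⟨hw, ⟨hX.1, h⟩, hX⟩
  leftInv := by
    rintro ⟨w, y⟩ ⟨hw, hy⟩
    have hX : opening (w, y) ∈ ArmX d n := shift_mem_ArmX (neg_mem_unitBall hw) hy.2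
    have hinv : ∀ i, shift w (opening (w, y) i) = y i := fun i =>
      shift_shift_neg hw (hy.2.1 i).le
    have hb := conformalBarycenter_eq hn hr hr2 hX hw (by simp only [hinv]; exact hy.1.2)
    simp only [closureMap, hb, hinv]
  rightInv := fun x hx => by
    obtain ⟨hw, -⟩ := conformalBarycenter_spec hn hr hr2 hx
    exact funext fun i => shift_neg_shift hw (hx.1 i).le
  smooth := smoothOnSubset_opening r
  smooth_inv := smoothOnSubset_closureMap hn hr hr2

end Closure

/-! ### Determinants of pulled back forms -/

section AbstractJacobian

open LinearMap (BilinForm)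
open Module

theorem det_prod_triangular {U K : Type*} [AddCommGroup U] [Module ℝ U] [FiniteDimensional ℝ U]
    [AddCommGroup K] [Module ℝ K] [FiniteDimensional ℝ K] (B : U →ₗ[ℝ] U) (L : U →ₗ[ℝ] K) :
    LinearMap.det ((B ∘ₗ LinearMap.fst ℝ U K).prod (L ∘ₗ LinearMap.fst ℝ U K +
      LinearMap.snd ℝ U K)) = LinearMap.det B := by
  classical
  let b := Module.Free.chooseBasis ℝ U
  let b' := Module.Free.chooseBasis ℝ K
  have h : LinearMap.toMatrix (b.prod b') (b.prod b') ((B ∘ₗ LinearMap.fst ℝ U K).prod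
      (L ∘ₗ LinearMap.fst ℝ U K + LinearMap.snd ℝ U K)) =
      Matrix.fromBlocks (LinearMap.toMatrix b b B) 0 (LinearMap.toMatrix b b' L) 1 := by
    ext (i | i) (j | j) <;> simp [LinearMap.toMatrix_apply, Matrix.one_apply, Finsupp.single_apply,
      eq_comm]
  rw [← LinearMap.det_toMatrix (b.prod b'), h, Matrix.det_fromBlocks_zero₁₂, Matrix.det_one,
    mul_one, LinearMap.det_toMatrix]

/-- Two Gram matrices of the same form are compared, and the nonzero determinant of g cancels. -/
theorem det_mul_det_toMatrix_of_compLeft {T ι : Type*} [AddCommGroup T] [Module ℝ T] [Fintype ι]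
    [DecidableEq ι] (b : Basis ι ℝ T) (g : BilinForm ℝ T) (hg : g.Nondegenerate)
    {Z P Q : T →ₗ[ℝ] T} (h : ∀ x y, g (Z x) y = g (P x) (Q y)) :
    LinearMap.det Z = LinearMap.det P * LinearMap.det Q := by
  have h0 : (LinearMap.BilinForm.toMatrix b g).det ≠ 0 := (BilinForm.nondegenerate_iff_det_ne_zero b).1 hg
  have h1 : g.compLeft Z = g.comp P Q := by ext x y; exact h x y
  have h2 : (LinearMap.BilinForm.toMatrix b (g.compLeft Z)).det =
      (LinearMap.BilinForm.toMatrix b (g.comp P Q)).det := by rw [h1]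
  rw [LinearMap.BilinForm.toMatrix_compLeft, LinearMap.BilinForm.toMatrix_comp b b,
    Matrix.det_mul, Matrix.det_mul, Matrix.det_mul, Matrix.det_transpose, Matrix.det_transpose,
    LinearMap.det_toMatrix, LinearMap.det_toMatrix, LinearMap.det_toMatrix] at h2
  apply mul_right_cancel₀ h0
  rw [h2]
  ring

/-- The Gram determinant of the map `(u, v) ↦ X (v + A u)` on `U × ker c`. -/
theorem det_gram_of_ker {U V : Type*} [AddCommGroup U] [Module ℝ U] [FiniteDimensional ℝ U]
    [AddCommGroup V] [Module ℝ V] [FiniteDimensional ℝ V] (gU : BilinForm ℝ U)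
    (gV : BilinForm ℝ V) (hU : ∀ u, u ≠ 0 → 0 < gU u u) (hV : ∀ v, v ≠ 0 → 0 < gV v v)
    (hUs : ∀ u u', gU u u' = gU u' u) (hVs : ∀ v v', gV v v' = gV v' v)
    (c : V →ₗ[ℝ] U) (K : Submodule ℝ V)
    (hK : K = LinearMap.ker c) (cs A : U →ₗ[ℝ] V) (X : V →ₗ[ℝ] V)
    (hcs : ∀ u v, gV (cs u) v = gU u (c v)) (hinj : Function.Injective (c ∘ₗ cs))
    (Z : (U × K) →ₗ[ℝ] (U × K))
    (hZ : ∀ p q : U × K, gU (Z p).1 q.1 + gV (Z p).2 q.2 =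
      gV (X (p.2 + A p.1)) (q.2 + A q.1)) :
    LinearMap.det Z * LinearMap.det (c ∘ₗ cs) =
      LinearMap.det (c ∘ₗ A) ^ 2 * LinearMap.det X := by
  set S := LinearEquiv.ofInjectiveEndo (c ∘ₗ cs) hinj with hS
  have hSa : ∀ u, c (cs (S.symm u)) = u := fun u => S.apply_symm_apply u
  -- B u is chosen so that A u - cs (B u) lies in ker c.
  set B : U →ₗ[ℝ] U := S.symm.toLinearMap ∘ₗ c ∘ₗ A with hB
  have hcB : ∀ u, c (cs (B u)) = c (A u) := fun u => hSa _
  set L : U →ₗ[ℝ] K := (A - cs ∘ₗ B).codRestrict K (fun u => by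
    rw [hK, LinearMap.mem_ker]; simp [hcB]) with hL
  -- V splits orthogonally as the image of the adjoint cs plus ker c. In these coordinates v + A u
  -- becomes the block triangular map Q, of determinant det B.
  set Ψ : (U × K) →ₗ[ℝ] V := cs ∘ₗ LinearMap.fst ℝ U K + K.subtype ∘ₗ LinearMap.snd ℝ U K with hΨ
  have hΨa : ∀ p, Ψ p = cs p.1 + p.2 := fun p => rfl
  have hker : ∀ v : K, c v = 0 := fun v => LinearMap.mem_ker.1 (hK.le v.2)
  have hΨi : Function.Injective Ψ := by
    rw [← LinearMap.ker_eq_bot, LinearMap.ker_eq_bot']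
    rintro ⟨u, v⟩ h
    rw [hΨa] at h
    have h1 : c (cs u) = 0 := by
      have := congrArg c h
      simpa [hker] using this
    have h2 : u = 0 := hinj (by simpa using h1)
    subst h2
    simp only [map_zero, zero_add, Submodule.coe_eq_zero] at h
    rw [h]; rfl
  have hΨs : Function.Surjective Ψ := by
    intro x
    refine ⟨(S.symm (c x), ⟨x - cs (S.symm (c x)), ?_⟩), ?_⟩
    · rw [hK, LinearMap.mem_ker, map_sub, hSa, sub_self]
    · rw [hΨa]; simp
  set E := LinearEquiv.ofBijective Ψ ⟨hΨi, hΨs⟩ with hE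
  have hEa : ∀ p, E p = cs p.1 + p.2 := fun p => rfl
  set Q : (U × K) →ₗ[ℝ] (U × K) := (B ∘ₗ LinearMap.fst ℝ U K).prod (L ∘ₗ LinearMap.fst ℝ U K +
    LinearMap.snd ℝ U K) with hQ
  have hEQ : ∀ p, E (Q p) = p.2 + A p.1 := by
    intro p
    rw [hEa]
    change cs (B p.1) + ((A p.1 - cs (B p.1)) + (p.2 : V)) = _
    abel
  set X' : (U × K) →ₗ[ℝ] (U × K) := E.symm.toLinearMap ∘ₗ X ∘ₗ E.toLinearMap with hX'
  have hEX : ∀ p, E (X' p) = X (E p) := fun p => E.apply_symm_apply _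
  set N : (U × K) →ₗ[ℝ] (U × K) := (c ∘ₗ cs).prodMap LinearMap.id with hN
  set g : BilinForm ℝ (U × K) := gU.comp (LinearMap.fst ℝ U K) (LinearMap.fst ℝ U K) +
    gV.comp (K.subtype ∘ₗ LinearMap.snd ℝ U K) (K.subtype ∘ₗ LinearMap.snd ℝ U K) with hg
  have hga : ∀ p q, g p q = gU p.1 q.1 + gV p.2 q.2 := fun p q => rfl
  have hgpos : ∀ p, p ≠ 0 → 0 < g p p := by
    rintro ⟨u, v⟩ hp
    rw [hga]
    by_cases hu : u = 0
    · have hv : (v : V) ≠ 0 := by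
        intro hv
        apply hp
        rw [hu, Submodule.coe_eq_zero.1 hv]; rfl
      simpa [hu] using hV v hv
    · by_cases hv : (v : V) = 0
      · simpa [hv] using hU u hu
      · exact add_pos (hU u hu) (hV _ hv)
  have hgn : g.Nondegenerate := by
    constructor
    · intro p hp
      by_contra hne
      exact (hgpos p hne).ne' (hp p)
    · intro p hp
      by_contra hne
      exact (hgpos p hne).ne' (hp p)
  -- In these coordinates the metric of V differs from that of U × K only by c ∘ cs on the first
  -- factor, because the two summands are orthogonal.
  have hgN : ∀ p q, gV (E p) (E q) = g (N p) q := by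
    intro p q
    rw [hga, hEa, hEa]
    simp only [map_add, LinearMap.add_apply, hcs, hVs (p.2 : V) (cs q.1), hker, map_zero,
      add_zero, zero_add, hN, LinearMap.prodMap_apply, LinearMap.comp_apply, LinearMap.id_apply]
    rw [← hcs p.1, hVs, hcs, hUs]
  -- Hence det Z = det(c cs) · det X · (det B)², and det(c cs) · det B = det(c A).
  have key := det_mul_det_toMatrix_of_compLeft (Module.Free.chooseBasis ℝ (U × K)) g hgn
    (Z := Z) (P := N ∘ₗ X' ∘ₗ Q) (Q := Q) (fun p q => by
      rw [hga, hZ, ← hEQ, ← hEQ, ← hEX, hgN]; rfl)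
  have hdX : LinearMap.det X' = LinearMap.det X := LinearMap.det_conj X E.symm
  have hdN : LinearMap.det N = LinearMap.det (c ∘ₗ cs) := by
    rw [hN, LinearMap.det_prodMap, LinearMap.det_id, mul_one]
  have hdB : LinearMap.det (c ∘ₗ cs) * LinearMap.det B = LinearMap.det (c ∘ₗ A) := by
    rw [← LinearMap.det_comp]
    congr 1
    ext u
    exact hcB u
  rw [key, LinearMap.det_comp, LinearMap.det_comp, hdX, hdN, hQ, det_prod_triangular, ← hdB]
  ring

/-- The determinant of `D* D` can be computed in any other model of the domain. -/
theorem det_metricAdjoint_comp {T T' W : Type*} [AddCommGroup T] [Module ℝ T]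
    [FiniteDimensional ℝ T] [AddCommGroup T'] [Module ℝ T'] [AddCommGroup W] [Module ℝ W]
    (g : BilinForm ℝ T) (hg : g.Nondegenerate) (h : BilinForm ℝ W) (D : T →ₗ[ℝ] W)
    (e : T' ≃ₗ[ℝ] T) :
    ∃ Z : T' →ₗ[ℝ] T', LinearMap.det (metricAdjoint g hg h D ∘ₗ D) = LinearMap.det Z ∧
      ∀ p q, g (e (Z p)) (e q) = h (D (e p)) (D (e q)) := by
  refine ⟨e.symm.toLinearMap ∘ₗ (metricAdjoint g hg h D ∘ₗ D) ∘ₗ e.toLinearMap,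
    (LinearMap.det_conj _ e.symm).symm, fun p q => ?_⟩
  rw [← metricAdjoint_spec g hg h D]
  simp

theorem det_pi_smul {ι : Type*} [Fintype ι] {M : ι → Type*} [∀ i, AddCommGroup (M i)]
    [∀ i, Module ℝ (M i)] [∀ i, FiniteDimensional ℝ (M i)] {k : ℕ}
    (hk : ∀ i, finrank ℝ (M i) = k) (l : ι → ℝ) :
    LinearMap.det (LinearMap.pi fun i => l i • LinearMap.proj (R := ℝ) (φ := M) i) =
      (∏ i, l i) ^ k := by
  let e : (∀ i, M i) ≃ₗ[ℝ] (ι → Fin k → ℝ) := LinearEquiv.piCongrRight fun i =>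
    LinearEquiv.ofFinrankEq (M i) (Fin k → ℝ) (by simp [hk i])
  rw [← LinearMap.det_conj _ e]
  have h : (e.toLinearMap ∘ₗ (LinearMap.pi fun i => l i • LinearMap.proj (R := ℝ) (φ := M) i) ∘ₗ
      e.symm.toLinearMap) = LinearMap.pi (fun i => (l i • LinearMap.id).comp
        (LinearMap.proj (R := ℝ) (φ := fun _ => Fin k → ℝ) i)) := by
    ext1 x
    funext i
    simp [e]
  rw [h, LinearMap.det_pi, ← Finset.prod_pow]
  refine Finset.prod_congr rfl fun i _ => ?_
  simp

end AbstractJacobian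

/-! ### Determinants of sums of projections -/

section ProjectionDeterminant

variable {d n : ℕ}

theorem projSum_apply (c : Fin n → ℝ) (y : Fin n → Vec d) (a b : Fin d) :
    projSum c y a b = ∑ i, c i * ((if a = b then 1 else 0) - y i a * y i b) := by
  simp [projSum, Matrix.sum_apply, Matrix.one_apply]

theorem det_projOp (c : Fin n → ℝ) (y : Fin n → Vec d) :
    LinearMap.det (projOp c y) = (projSum c y).det := by
  rw [← LinearMap.det_toMatrix (EuclideanSpace.basisFun (Fin d) ℝ).toBasis]
  congr 1
  ext a b
  rw [projSum_apply, LinearMap.toMatrix_apply, projOp_apply]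
  simp only [OrthonormalBasis.coe_toBasis_repr_apply, EuclideanSpace.basisFun_repr,
    OrthonormalBasis.coe_toBasis, EuclideanSpace.basisFun_apply]
  rw [WithLp.ofLp_sum, Finset.sum_apply]
  refine Finset.sum_congr rfl fun i _ => ?_
  simp [EuclideanSpace.inner_single_right, mul_comm]

theorem projSum_posDef (hn : 3 ≤ n) {y : Fin n → Vec d} (hy : y ∈ ArmX d n)
    {c : Fin n → ℝ} (hc : ∀ i, 0 < c i) : (projSum c y).PosDef := by
  refine Matrix.PosDef.of_dotProduct_mulVec_pos ?_ fun x hx => ?_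
  · ext a b
    simp [projSum_apply, eq_comm, mul_comm]
  · have hx' : WithLp.toLp 2 x ≠ 0 := fun h => hx (by simpa using h)
    have h := sum_norm_sq_sub_inner_sq_pos hn hy hc hx'
    refine h.trans_eq ?_
    have hin : ∀ i, inner ℝ (y i) (WithLp.toLp 2 x) = ∑ a, y i a * x a := fun i => by
      simp [PiLp.inner_apply, mul_comm]
    have hno : ‖WithLp.toLp 2 x‖ ^ 2 = ∑ a, x a * x a := by
      rw [EuclideanSpace.norm_sq_eq]
      exact Finset.sum_congr rfl fun a _ => by simp [sq]
    simp only [hin, hno, dotProduct, Matrix.mulVec, projSum_apply, star_trivial]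
    have : ∀ a, x a * ∑ b, (∑ i, c i * ((if a = b then 1 else 0) - y i a * y i b)) * x b =
        ∑ i, c i * (x a * x a - x a * (y i a * ∑ b, y i b * x b)) := by
      intro a
      simp only [Finset.sum_mul]
      rw [Finset.sum_comm, Finset.mul_sum]
      refine Finset.sum_congr rfl fun i _ => ?_
      have h1 : ∀ b, c i * ((if a = b then 1 else 0) - y i a * y i b) * x b =
          c i * (if a = b then x b else 0) - c i * y i a * (y i b * x b) := by
        intro b; split_ifs <;> ring
      simp only [h1, Finset.sum_sub_distrib, ← Finset.mul_sum, Finset.sum_ite_eq,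
        Finset.mem_univ, if_true]
      ring
    simp only [this]
    rw [Finset.sum_comm]
    refine Finset.sum_congr rfl fun i _ => ?_
    rw [← Finset.mul_sum, Finset.sum_sub_distrib, sq (∑ a, y i a * x a)]
    congr 2
    rw [Finset.sum_mul]
    exact Finset.sum_congr rfl fun a _ => by ring

end ProjectionDeterminant

/-! ### The tangent spaces of `𝔹 × Pol^×` -/

section TangentSpace

open Filter Topology

/-- On a set without unique derivatives `fderivWithin` involves a choice. Any two derivatives within
M nevertheless agree on velocities of curves in M, hence on their span, so a smooth ambient
extension may be differentiated instead. -/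
theorem fderivWithin_apply_of_mem_tangentSpaceAt {E F : Type*} [NormedAddCommGroup E]
    [NormedSpace ℝ E] [NormedAddCommGroup F] [NormedSpace ℝ F] {f f' : E → F} {M : Set E} {p : E}
    (hp : p ∈ M) (hf : DifferentiableAt ℝ f' p) (heq : Set.EqOn f f' M) {v : E}
    (hv : v ∈ tangentSpaceAt M p) : fderivWithin ℝ f M p v = fderiv ℝ f' p v := by
  have h1 : HasFDerivWithinAt f (fderiv ℝ f' p) M p :=
    hf.hasFDerivAt.hasFDerivWithinAt.congr heq (heq hp)
  have h2 : HasFDerivWithinAt f (fderivWithin ℝ f M p) M p :=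
    h1.differentiableWithinAt.hasFDerivWithinAt
  refine LinearMap.eqOn_span (f := (fderivWithin ℝ f M p).toLinearMap)
    (g := (fderiv ℝ f' p).toLinearMap) ?_ hv
  rintro _ ⟨γ, ε, hε, hγ, hγM, rfl, rfl⟩
  have h0 : (0 : ℝ) ∈ Set.Ioo (-ε) ε := ⟨by linarith, hε⟩
  have hn : Set.Ioo (-ε) ε ∈ 𝓝 (0 : ℝ) := isOpen_Ioo.mem_nhds h0
  have hd : HasDerivWithinAt γ (deriv γ 0) (Set.Ioo (-ε) ε) 0 :=
    (((hγ.contDiffAt hn).differentiableAt (by simp)).hasDerivAt).hasDerivWithinAt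
  have e1 := (h1.comp_hasDerivWithinAt 0 hd hγM).hasDerivAt hn
  have e2 := (h2.comp_hasDerivWithinAt 0 hd hγM).hasDerivAt hn
  exact e2.unique e1

variable {d n : ℕ}

theorem tangent_of_mem_tangentSpaceAt {r : Fin n → ℝ} {w : Vec d} {y : Fin n → Vec d}
    {p : Vec d × (Fin n → Vec d)} (hp : p ∈ tangentSpaceAt (unitBall d ×ˢ PolX d r) (w, y)) :
    (∀ i, inner ℝ (y i) (p.2 i) = 0) ∧ ∑ i, r i • p.2 i = 0 := by
  induction hp using Submodule.span_induction with
  | zero => simp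
  | add a b _ _ ha hb =>
    refine ⟨fun i => ?_, ?_⟩
    · simp [inner_add_right, ha.1 i, hb.1 i]
    · simp [Finset.sum_add_distrib, ha.2, hb.2]
  | smul c a _ ha =>
    refine ⟨fun i => by simp [inner_smul_right, ha.1 i], ?_⟩
    simp only [Prod.smul_snd, Pi.smul_apply, smul_comm _ c]
    rw [← Finset.smul_sum, ha.2, smul_zero]
  | mem v hv =>
    obtain ⟨γ, ε, hε, hγ, hγM, h0, rfl⟩ := hv
    have hn : Set.Ioo (-ε) ε ∈ 𝓝 (0 : ℝ) := isOpen_Ioo.mem_nhds ⟨by linarith, hε⟩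
    have hd : HasDerivAt γ (deriv γ 0) 0 :=
      ((hγ.contDiffAt hn).differentiableAt (by simp)).hasDerivAt
    have hd2 : ∀ i, HasDerivAt (fun t => (γ t).2 i) ((deriv γ 0).2 i) 0 :=
      hasDerivAt_pi.1 hd.snd
    constructor
    · intro i
      have h1 := (hd2 i).norm_sq
      have h2 : HasDerivAt (fun t => ‖(γ t).2 i‖ ^ 2) 0 0 := by
        refine (hasDerivAt_const (0 : ℝ) (1 : ℝ)).congr_of_eventuallyEq ?_
        filter_upwards [hn] with t ht
        rw [(hγM t ht).2.2.1 i]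
        norm_num
      have h3 := h1.unique h2
      rw [h0] at h3
      simpa using h3
    · have h1 : HasDerivAt (fun t => ∑ i, r i • (γ t).2 i) (∑ i, r i • (deriv γ 0).2 i) 0 :=
        HasDerivAt.fun_sum fun i _ => (hd2 i).const_smul (r i)
      have h2 : HasDerivAt (fun t => ∑ i, r i • (γ t).2 i) 0 0 := by
        refine (hasDerivAt_const (0 : ℝ) (0 : Vec d)).congr_of_eventuallyEq ?_
        filter_upwards [hn] with t ht
        exact (hγM t ht).2.1.2
      exact h1.unique h2

theorem sphereShift_zero {y : Vec d} (hy : ‖y‖ = 1) : sphereShift 0 y = y := by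
  simp [sphereShift, hy]

/-- Normalise yᵢ + t vᵢ to a curve on the spheres, then close it up by shifting with its barycenter.
Since ∑ rᵢvᵢ = 0, the barycenter is stationary at t = 0, so closing does not alter the velocity v.
-/
theorem mem_tangentSpaceAt_of_tangent (hn : 3 ≤ n) {r : Fin n → ℝ} (hr : ∀ i, 0 < r i)
    {w : Vec d} (hw : w ∈ unitBall d) {y : Fin n → Vec d} (hy : y ∈ PolX d r)
    {p : Vec d × (Fin n → Vec d)} (hp : ∀ i, inner ℝ (y i) (p.2 i) = 0)
    (hp' : ∑ i, r i • p.2 i = 0) : p ∈ tangentSpaceAt (unitBall d ×ˢ PolX d r) (w, y) := by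
  obtain ⟨u, v⟩ := p
  simp only at hp hp'
  have h0b : (0 : Vec d) ∈ unitBall d := by simp [unitBall]
  have hunit := hy.2.1
  obtain ⟨β, hβ, hβy, hβ0, hβd⟩ := exists_local_barycenter hn hr hy.2 h0b
    (by simpa only [shift_zero_left] using hy.1.2)
  -- At the centre 0 the derivative of the shift in a tangent direction is the identity, so the
  -- derivative of the equation is ∑ rᵢvᵢ.
  have hβv : fderiv ℝ β y v = 0 := by
    refine hβd v ?_
    rw [fderiv_barycenterEq r hunit h0b]
    refine Eq.trans ?_ hp'
    refine Finset.sum_congr rfl fun i _ => ?_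
    rw [fderiv_sphereShift (by simp [hunit i])]
    simp [hunit i, hp i]
  -- As yᵢ ⊥ vᵢ, the root is the norm of yᵢ + t vᵢ; it equals 1 to first order at t = 0.
  set x : ℝ → Fin n → Vec d := fun t i => (√(1 + t ^ 2 * ‖v i‖ ^ 2))⁻¹ • (y i + t • v i) with hx
  have hpos : ∀ t i, 0 < 1 + t ^ 2 * ‖v i‖ ^ 2 := fun t i => by positivity
  have hx0 : x 0 = y := by
    funext i
    simp [hx]
  have hxs : ContDiff ℝ ω x := by
    refine contDiff_pi.2 fun i => ?_
    have h1 : ContDiff ℝ ω (fun t : ℝ => √(1 + t ^ 2 * ‖v i‖ ^ 2)) :=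
      ContDiff.sqrt (by fun_prop) fun t => (hpos t i).ne'
    exact (h1.inv fun t => (Real.sqrt_pos.2 (hpos t i)).ne').smul (by fun_prop)
  have hxu : ∀ t i, ‖x t i‖ = 1 := by
    intro t i
    have h1 : ‖y i + t • v i‖ = √(1 + t ^ 2 * ‖v i‖ ^ 2) := by
      have := norm_sq_lincomb 1 t (y i) (v i)
      rw [one_smul, hunit i, hp i] at this
      rw [← Real.sqrt_sq (norm_nonneg (y i + t • v i)), this]
      congr 1
      ring
    have h2 := Real.sqrt_pos.2 (hpos t i)
    simp only [hx]
    rw [norm_smul, h1, norm_inv, Real.norm_eq_abs, abs_of_pos h2, inv_mul_cancel₀ h2.ne']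
  have hxd : HasDerivAt x v 0 := by
    refine hasDerivAt_pi.2 fun i => ?_
    have h1 : HasDerivAt (fun t : ℝ => 1 + t ^ 2 * ‖v i‖ ^ 2) 0 0 := by
      simpa using (((hasDerivAt_id (0 : ℝ)).fun_pow 2).mul_const (‖v i‖ ^ 2)).const_add 1
    have h2 := ((h1.sqrt (by simp)).fun_inv (by simp)).smul
      (((hasDerivAt_id (0 : ℝ)).smul_const (v i)).const_add (y i))
    have h3 := h2.congr_deriv (g' := v i) (by simp)
    exact h3
  have hβx : HasDerivAt (fun t => β (x t)) 0 0 := by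
    have h1 : HasFDerivAt β (fderiv ℝ β y) (x 0) := by
      rw [hx0]; exact (hβ.differentiableAt (by simp)).hasFDerivAt
    have := h1.comp_hasDerivAt (0 : ℝ) hxd
    rwa [hβv] at this
  set c : ℝ → Vec d × (Fin n → Vec d) := fun t =>
    (w + t • u, fun i => sphereShift (-β (x t)) (x t i)) with hc
  have hβs : ContDiffAt ℝ ω (fun t => β (x t)) 0 :=
    ContDiffAt.comp (0 : ℝ) (by rw [hx0]; exact hβ) hxs.contDiffAt
  have hcs : ContDiffAt ℝ ω c 0 := by
    refine ContDiffAt.prodMk (by fun_prop) (contDiffAt_pi.2 fun i => ?_)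
    have h1 := contDiffAt_sphereShift_negSndProj (m := ω) (x := x 0) (w := β (x 0)) (hxu 0)
      (by rw [hx0, hβy]; exact h0b) i
    have h2 := ContDiffAt.comp (0 : ℝ) h1 (hxs.contDiffAt.prodMk hβs)
    exact h2
  have hc0 : c 0 = (w, y) := by
    simp only [hc, zero_smul, add_zero, hx0, hβy, neg_zero]
    exact Prod.ext rfl (funext fun i => sphereShift_zero (hunit i))
  have hcd : HasDerivAt c (u, v) 0 := by
    have h1 : HasDerivAt (fun t : ℝ => w + t • u) u 0 := by
      simpa using ((hasDerivAt_id (0 : ℝ)).smul_const u).const_add w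
    refine h1.prodMk (hasDerivAt_pi.2 fun i => ?_)
    have hne : ‖y i + 0‖ ^ 2 ≠ 0 := by simp [hunit i]
    have h2 : HasFDerivAt (fun p : Vec d × Vec d => sphereShift p.1 p.2)
        (fderiv ℝ (fun p : Vec d × Vec d => sphereShift p.1 p.2) (0, y i)) (-β (x 0), x 0 i) := by
      rw [hx0, hβy, neg_zero]
      exact ((contDiffAt_sphereShift (m := 1) (p := (0, y i)) hne).differentiableAt
        one_ne_zero).hasFDerivAt
    have h3 := h2.comp_hasDerivAt (0 : ℝ) (hβx.neg.prodMk (hasDerivAt_pi.1 hxd i))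
    rw [neg_zero, fderiv_sphereShift hne] at h3
    have h4 := h3.congr_deriv (g' := v i) (by simp [hunit i, hp i])
    exact h4
  have hev : ∀ᶠ t in 𝓝 (0 : ℝ), ContDiffAt ℝ ω c t ∧ c t ∈ unitBall d ×ˢ PolX d r := by
    have e1 : ∀ᶠ t in 𝓝 (0 : ℝ), w + t • u ∈ unitBall d := by
      have hcont : ContinuousAt (fun t : ℝ => w + t • u) 0 := by fun_prop
      exact hcont.eventually_mem (Metric.isOpen_ball.mem_nhds (by
        simpa using mem_unitBall_iff.1 hw))
    have e2 : ∀ᶠ t in 𝓝 (0 : ℝ), β (x t) ∈ unitBall d :=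
      hβs.continuousAt.eventually_mem (Metric.isOpen_ball.mem_nhds (by
        rw [hx0, hβy]; exact h0b))
    have hxt : Tendsto x (𝓝 0) (𝓝 y) := by
      have := hxs.continuous.tendsto 0
      rwa [hx0] at this
    have e3 := hxt.eventually hβ0
    have e4 : ∀ᶠ t in 𝓝 (0 : ℝ), x t ∈ {x : Fin n → Vec d | ∀ i j, i ≠ j → x i ≠ x j} :=
      hxt.eventually_mem (isOpen_distinct.mem_nhds hy.2.2)
    filter_upwards [hcs.eventually (by simp), e1, e2, e3, e4] with t h1 h2 h3 h4 h5
    refine ⟨h1, h2, ?_⟩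
    have hX : x t ∈ ArmX d n := ⟨hxu t, h5⟩
    have heq : (c t).2 = fun i => shift (β (x t)) (x t i) := funext fun i => by
      simp only [hc]
      rw [sphereShift_eq (neg_mem_unitBall h3) (hxu t i), neg_neg]
    rw [barycenterEq_of_mem r (hxu t) h3] at h4
    have hX' := shift_mem_ArmX h3 hX
    rw [heq]
    exact ⟨⟨hX'.1, h4⟩, hX'⟩
  obtain ⟨ε, hε, hball⟩ := Metric.eventually_nhds_iff_ball.1 hev
  rw [Real.ball_eq_Ioo, zero_sub, zero_add] at hball
  exact Submodule.subset_span ⟨c, ε, hε,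
    fun t ht => ((hball t ht).1.of_le le_top).contDiffWithinAt, fun t ht => (hball t ht).2, hc0,
    hcd.deriv⟩

end TangentSpace

/-! ### The Jacobian of the opening map -/

section Jacobian

open Module

variable {d n : ℕ}

/-- Invariance under the reflection in e^⊥ is what removes the reflections from the Gram
determinant. -/
theorem inner_reflection {e : Vec d} (he : ‖e‖ ^ 2 ≠ 0) (x x' : Vec d) :
    inner ℝ (x - (2 * inner ℝ e x / ‖e‖ ^ 2) • e) (x' - (2 * inner ℝ e x' / ‖e‖ ^ 2) • e) =
      inner ℝ x x' := by
  simp only [inner_sub_left, inner_sub_right, inner_smul_left, inner_smul_right,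
    real_inner_self_eq_norm_sq, real_inner_comm e x, conj_trivial]
  generalize ‖e‖ ^ 2 = D at *
  field_simp
  ring

theorem mem_orthogonal_span_singleton {y v : Vec d} :
    v ∈ (Submodule.span ℝ {y})ᗮ ↔ inner ℝ y v = 0 :=
  Submodule.mem_orthogonal_singleton_iff_inner_right

/-- The orthogonal projection onto the tangent space of the sphere at `y`. -/
def tangentProj (y : Vec d) (hy : ‖y‖ = 1) : Vec d →ₗ[ℝ] (Submodule.span ℝ {y})ᗮ :=
  LinearMap.codRestrict _ (LinearMap.id - (innerₛₗ ℝ y).smulRight y) fun u => by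
    rw [mem_orthogonal_span_singleton]
    simp [inner_sub_right, inner_smul_right, hy]

/-- The tangent vector at `y` that corresponds to a displacement `u` of the centre `w`. -/
def centerField (w y : Vec d) (hy : ‖y‖ = 1) : Vec d →ₗ[ℝ] (Submodule.span ℝ {y})ᗮ :=
  (2 / (1 - ‖w‖ ^ 2)) • (tangentProj y hy + LinearMap.codRestrict _
    ((inner ℝ y w : ℝ) • LinearMap.id - (innerₛₗ ℝ y).smulRight w) fun u => by
      rw [mem_orthogonal_span_singleton]
      simp [inner_sub_right, inner_smul_right, mul_comm])

theorem coe_centerField {w y : Vec d} (hy : ‖y‖ = 1) (u : Vec d) :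
    (centerField w y hy u : Vec d) = (2 / (1 - ‖w‖ ^ 2)) • ((u - inner ℝ y u • y) +
      (inner ℝ y w • u - inner ℝ y u • w)) := rfl

/-- The tangent space at `y` of the configurations of unit vectors. -/
abbrev ArmTangent (y : Fin n → Vec d) : Type := ∀ i, (Submodule.span ℝ {y i})ᗮ

/-- The inclusion of the tangent space of the configurations of unit vectors. -/
def armInclusion (y : Fin n → Vec d) : ArmTangent y →ₗ[ℝ] (Fin n → Vec d) :=
  LinearMap.pi fun i => Submodule.subtype _ ∘ₗ LinearMap.proj i

theorem inner_coe_armTangent {y : Fin n → Vec d} (v : ArmTangent y) (i : Fin n) :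
    inner ℝ (y i) (v i : Vec d) = 0 := mem_orthogonal_span_singleton.1 (v i).2

/-- The differential of the closing condition. -/
def closingDifferential (r : Fin n → ℝ) (y : Fin n → Vec d) : ArmTangent y →ₗ[ℝ] Vec d :=
  ∑ i, r i • (Submodule.subtype _ ∘ₗ LinearMap.proj i)

theorem closingDifferential_apply (r : Fin n → ℝ) (y : Fin n → Vec d) (v : ArmTangent y) :
    closingDifferential r y v = ∑ i, r i • (v i : Vec d) := by
  simp [closingDifferential]

theorem armMetric_apply (ϱ : Fin n → ℝ) (u v : Fin n → Vec d) :
    armMetric d ϱ u v = ∑ i, ϱ i ^ 2 * inner ℝ (u i) (v i) := rfl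

/-- A model of the tangent space of `𝔹 × Pol^×`. -/
def tangentModel (r : Fin n → ℝ) (y : Fin n → Vec d) :
    (Vec d × LinearMap.ker (closingDifferential r y)) →ₗ[ℝ] Vec d × (Fin n → Vec d) :=
  LinearMap.id.prodMap (armInclusion y ∘ₗ Submodule.subtype _)

theorem tangentModel_injective (r : Fin n → ℝ) (y : Fin n → Vec d) :
    Function.Injective (tangentModel r y) := by
  rintro ⟨u, v⟩ ⟨u', v'⟩ h
  change (u, armInclusion y v.1) = (u', armInclusion y v'.1) at h
  obtain ⟨h1, h2⟩ := Prod.mk.inj h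
  exact Prod.ext h1 (Subtype.ext (funext fun i => Subtype.ext (congrFun h2 i)))

theorem range_tangentModel (hn : 3 ≤ n) {r : Fin n → ℝ} (hr : ∀ i, 0 < r i) {w : Vec d}
    (hw : w ∈ unitBall d) {y : Fin n → Vec d} (hy : y ∈ PolX d r) :
    LinearMap.range (tangentModel r y) = tangentSpaceAt (unitBall d ×ˢ PolX d r) (w, y) := by
  ext p
  constructor
  · rintro ⟨⟨u, v⟩, rfl⟩
    refine mem_tangentSpaceAt_of_tangent hn hr hw hy (inner_coe_armTangent v.1) ?_
    have h := v.2
    rw [LinearMap.mem_ker, closingDifferential_apply] at h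
    exact h
  · intro hp
    obtain ⟨h1, h2⟩ := tangent_of_mem_tangentSpaceAt hp
    refine ⟨(p.1, ⟨fun i => ⟨p.2 i, mem_orthogonal_span_singleton.2 (h1 i)⟩, ?_⟩), rfl⟩
    rw [LinearMap.mem_ker, closingDifferential_apply]
    exact h2

theorem fderivWithin_opening {r : Fin n → ℝ} {w : Vec d} (hw : w ∈ unitBall d)
    {y : Fin n → Vec d} (hy : y ∈ PolX d r) {p : Vec d × (Fin n → Vec d)}
    (hp : p ∈ tangentSpaceAt (unitBall d ×ˢ PolX d r) (w, y)) (i : Fin n) :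
    fderivWithin ℝ opening (unitBall d ×ˢ PolX d r) (w, y) p i =
      fderiv ℝ (fun p : Vec d × Vec d => sphereShift p.1 p.2) (w, y i) (p.1, p.2 i) := by
  have hterm : ∀ i, HasFDerivAt (fun p : Vec d × (Fin n → Vec d) => sphereShift p.1 (p.2 i))
      ((fderiv ℝ (fun p : Vec d × Vec d => sphereShift p.1 p.2) (w, y i)).comp
        ((ContinuousLinearMap.fst ℝ _ _).prod ((ContinuousLinearMap.proj (R := ℝ)
          (φ := fun _ : Fin n => Vec d) i).comp (ContinuousLinearMap.snd ℝ _ _)))) (w, y) := by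
    intro i
    have h1 := ((contDiffAt_sphereShift (m := 1) (p := (w, y i))
      (add_norm_sq_pos hw (hy.2.1 i)).ne').differentiableAt one_ne_zero).hasFDerivAt
    have h2 : HasFDerivAt (fun p : Vec d × (Fin n → Vec d) => (p.1, p.2 i)) _ (w, y) :=
      ((ContinuousLinearMap.fst ℝ (Vec d) (Fin n → Vec d)).prod
        ((ContinuousLinearMap.proj (R := ℝ) (φ := fun _ : Fin n => Vec d) i).comp
          (ContinuousLinearMap.snd ℝ (Vec d) (Fin n → Vec d)))).hasFDerivAt
    exact HasFDerivAt.comp (w, y) h1 h2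
  have hf := hasFDerivAt_pi.2 hterm
  have heq : Set.EqOn opening (fun p : Vec d × (Fin n → Vec d) => fun i => sphereShift p.1 (p.2 i))
      (unitBall d ×ˢ PolX d r) := fun p hp =>
    funext fun i => (sphereShift_eq hp.1 (hp.2.2.1 i)).symm
  rw [fderivWithin_apply_of_mem_tangentSpaceAt (Set.mk_mem_prod hw hy) hf.differentiableAt heq hp,
    hf.fderiv]
  rfl

theorem armMetric_differential_opening {r : Fin n → ℝ} (ϱ : Fin n → ℝ) {w : Vec d}
    (hw : w ∈ unitBall d) {y : Fin n → Vec d} (hy : y ∈ PolX d r)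
    {p q : Vec d × (Fin n → Vec d)}
    (hp : p ∈ tangentSpaceAt (unitBall d ×ˢ PolX d r) (w, y))
    (hq : q ∈ tangentSpaceAt (unitBall d ×ˢ PolX d r) (w, y)) :
    armMetric d ϱ (fderivWithin ℝ opening (unitBall d ×ˢ PolX d r) (w, y) p)
      (fderivWithin ℝ opening (unitBall d ×ˢ PolX d r) (w, y) q) =
    ∑ i, ϱ i ^ 2 * (((1 - ‖w‖ ^ 2) / ‖y i + w‖ ^ 2) ^ 2 *
      inner ℝ (p.2 i + (centerField w (y i) (hy.2.1 i) p.1 : Vec d))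
        (q.2 i + (centerField w (y i) (hy.2.1 i) q.1 : Vec d))) := by
  rw [armMetric_apply]
  refine Finset.sum_congr rfl fun i _ => ?_
  rw [fderivWithin_opening hw hy hp, fderivWithin_opening hw hy hq]
  obtain ⟨x, hx, hxe⟩ := fderiv_sphereShift_tangent hw (hy.2.1 i) (u := p.1)
    ((tangent_of_mem_tangentSpaceAt hp).1 i)
  obtain ⟨x', hx', hxe'⟩ := fderiv_sphereShift_tangent hw (hy.2.1 i) (u := q.1)
    ((tangent_of_mem_tangentSpaceAt hq).1 i)
  rw [hxe, hxe', real_inner_smul_left, real_inner_smul_right,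
    inner_reflection (add_norm_sq_pos hw (hy.2.1 i)).ne', coe_centerField, coe_centerField, ← hx,
    ← hx']
  ring

theorem finrank_orthogonal_of_unit (hd : 2 ≤ d) {y : Vec d} (hy : ‖y‖ = 1) :
    finrank ℝ (Submodule.span ℝ {y})ᗮ = d - 1 := by
  have : Fact (finrank ℝ (Vec d) = (d - 1) + 1) := ⟨by
    rw [finrank_euclideanSpace_fin]; omega⟩
  refine Submodule.finrank_orthogonal_span_singleton fun h => ?_
  simp [h] at hy

theorem gram_det_opening (hd : 2 ≤ d) (hn : 3 ≤ n) {r ϱ : Fin n → ℝ} (hr : ∀ i, 0 < r i)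
    (hϱ : ∀ i, 0 < ϱ i) {w : Vec d} (hw : w ∈ unitBall d) {y : Fin n → Vec d}
    (hy : y ∈ PolX d r) :
    Jop r ϱ hϱ w y = √((((2 / (1 - ‖w‖ ^ 2)) ^ d * (projSum r y).det) ^ 2 *
      (∏ i, ((1 - ‖w‖ ^ 2) / ‖y i + w‖ ^ 2) ^ 2) ^ (d - 1)) /
        (projSum (fun i => r i ^ 2 / ϱ i ^ 2) y).det) := by
  have hu := hy.2.1
  have hcpos : ∀ i, 0 < r i ^ 2 / ϱ i ^ 2 := fun i => div_pos (pow_pos (hr i) 2) (pow_pos (hϱ i) 2)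
  set M := unitBall d ×ˢ PolX d r with hM
  have hrange := range_tangentModel hn hr hw hy
  rw [← hM] at hrange
  let e : (Vec d × LinearMap.ker (closingDifferential r y)) ≃ₗ[ℝ] tangentSpaceAt M (w, y) :=
    (LinearEquiv.ofInjective _ (tangentModel_injective r y)).trans (LinearEquiv.ofEq _ _ hrange)
  obtain ⟨Z, hZdet, hZ⟩ := det_metricAdjoint_comp
    ((ballPolMetric d ϱ).restrict (tangentSpaceAt M (w, y)))
    (restrict_nondegenerate (ballPolMetric d ϱ) (ballPolMetric_pos d ϱ hϱ) (tangentSpaceAt M (w, y)))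
    (armMetric d ϱ) (differentialAlong opening M (w, y)) e
  let gV : LinearMap.BilinForm ℝ (ArmTangent y) :=
    (armMetric d ϱ).comp (armInclusion y) (armInclusion y)
  have hgV : ∀ a b, gV a b = ∑ i, ϱ i ^ 2 * inner ℝ (a i : Vec d) (b i : Vec d) := fun a b => rfl
  -- The adjoint of the closing differential for the ϱ-weighted metric: the weight ϱᵢ² must be
  -- divided out.
  let cs : Vec d →ₗ[ℝ] ArmTangent y :=
    LinearMap.pi fun i => (r i / ϱ i ^ 2) • tangentProj (y i) (hu i)
  let A : Vec d →ₗ[ℝ] ArmTangent y := LinearMap.pi fun i => centerField w (y i) (hu i)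
  let X : ArmTangent y →ₗ[ℝ] ArmTangent y := LinearMap.pi fun i =>
    (((1 - ‖w‖ ^ 2) / ‖y i + w‖ ^ 2) ^ 2) • LinearMap.proj i
  have hcs : closingDifferential r y ∘ₗ cs = projOp (fun i => r i ^ 2 / ϱ i ^ 2) y := by
    ext1 u
    rw [LinearMap.comp_apply, closingDifferential_apply, projOp_apply]
    refine Finset.sum_congr rfl fun i _ => ?_
    change r i • ((r i / ϱ i ^ 2) • (u - inner ℝ (y i) u • y i)) = _
    rw [smul_smul]
    congr 1
    ring
  -- The part of Aᵢ that is not a projection is linear in yᵢ and sums to zero because y is closed.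
  have hcA : closingDifferential r y ∘ₗ A = (2 / (1 - ‖w‖ ^ 2)) • projOp r y := by
    ext1 u
    have hsum : ∀ a : Vec d, ∑ i, r i * inner ℝ (y i) a = 0 := fun a => by
      have : inner ℝ (∑ i, r i • y i) a = 0 := by rw [hy.1.2, inner_zero_left]
      simpa only [sum_inner, real_inner_smul_left] using this
    rw [LinearMap.comp_apply, closingDifferential_apply, LinearMap.smul_apply, projOp_apply]
    have hterm : ∀ i, r i • (A u i : Vec d) =
        (2 / (1 - ‖w‖ ^ 2)) • (r i • (u - inner ℝ (y i) u • y i)) +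
        (2 / (1 - ‖w‖ ^ 2)) • ((r i * inner ℝ (y i) w) • u - (r i * inner ℝ (y i) u) • w) := by
      intro i
      change r i • (centerField w (y i) (hu i) u : Vec d) = _
      rw [coe_centerField]
      module
    rw [Finset.sum_congr rfl fun i _ => hterm i, Finset.sum_add_distrib, ← Finset.smul_sum,
      ← Finset.smul_sum, Finset.sum_sub_distrib, ← Finset.sum_smul, ← Finset.sum_smul, hsum, hsum]
    simp
  have key := det_gram_of_ker (innerₗ (Vec d)) gV
    (fun u hu => by simpa using real_inner_self_pos.2 hu) (fun v hv => ?_)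
    (fun u u' => by simp [real_inner_comm]) (fun v v' => by
      rw [hgV, hgV]
      exact Finset.sum_congr rfl fun i _ => by rw [real_inner_comm])
    (closingDifferential r y) _ rfl cs A X (fun u v => ?_)
    (by rw [hcs]; exact projOp_injective hn hy.2 hcpos) Z (fun p q => ?_)
  · rw [hcs, hcA, LinearMap.det_smul, det_projOp, det_projOp, finrank_euclideanSpace_fin,
      det_pi_smul (fun i => finrank_orthogonal_of_unit hd (hu i))] at key
    have hpos := (projSum_posDef hn hy.2 hcpos).det_pos
    rw [← key, mul_div_cancel_right₀ _ hpos.ne', ← hZdet]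
    rfl
  · rw [hgV]
    obtain ⟨i, hi⟩ := Function.ne_iff.1 hv
    refine Finset.sum_pos' (fun i _ => mul_nonneg (sq_nonneg _) real_inner_self_nonneg)
      ⟨i, Finset.mem_univ _, mul_pos (pow_pos (hϱ i) 2) (real_inner_self_pos.2 ?_)⟩
    simpa using hi
  · rw [hgV, closingDifferential_apply, innerₗ_apply_apply, inner_sum]
    refine Finset.sum_congr rfl fun i _ => ?_
    change ϱ i ^ 2 * inner ℝ ((r i / ϱ i ^ 2) • (u - inner ℝ (y i) u • y i)) (v i : Vec d) = _
    rw [real_inner_smul_left, inner_sub_left, real_inner_smul_left, inner_coe_armTangent,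
      real_inner_smul_right]
    have := (hϱ i).ne'
    field_simp
    ring
  · have h1 := hZ p q
    have h2 := armMetric_differential_opening ϱ hw hy (e p).2 (e q).2
    refine h1.trans (h2.trans ?_)
    rw [hgV]
    refine Finset.sum_congr rfl fun i _ => ?_
    congr 1
    exact (real_inner_smul_left _ _ _).symm

theorem Jop_eq (hd : 2 ≤ d) (hn : 3 ≤ n) {r ϱ : Fin n → ℝ} (hr : ∀ i, 0 < r i)
    (hϱ : ∀ i, 0 < ϱ i) {w : Vec d} (hw : w ∈ unitBall d) {y : Fin n → Vec d}
    (hy : y ∈ PolX d r) :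
    Jop r ϱ hϱ w y = (2 / (1 - ‖w‖ ^ 2)) ^ d *
      ((projSum r y).det / √(projSum (fun i => r i ^ 2 / ϱ i ^ 2) y).det) *
      (∏ i, (1 - ‖w‖ ^ 2) / ‖w + y i‖ ^ 2) ^ (d - 1) ∧ Jop r ϱ hϱ w y ≠ 0 := by
  have hq := sub_pos.2 (norm_sq_lt_one hw)
  have h1 := (projSum_posDef hn hy.2 hr).det_pos
  have h2 := (projSum_posDef hn hy.2
    (fun i => div_pos (pow_pos (hr i) 2) (pow_pos (hϱ i) 2))).det_pos
  have h3 : 0 < ∏ i, (1 - ‖w‖ ^ 2) / ‖w + y i‖ ^ 2 := Finset.prod_pos fun i _ => by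
    rw [add_comm]
    exact div_pos hq (add_norm_sq_pos hw (hy.2.1 i))
  have h4 : Jop r ϱ hϱ w y = (2 / (1 - ‖w‖ ^ 2)) ^ d *
      ((projSum r y).det / √(projSum (fun i => r i ^ 2 / ϱ i ^ 2) y).det) *
      (∏ i, (1 - ‖w‖ ^ 2) / ‖w + y i‖ ^ 2) ^ (d - 1) := by
    rw [gram_det_opening hd hn hr hϱ hw hy]
    simp only [add_comm (y _) w]
    rw [Finset.prod_pow, ← pow_mul, mul_comm 2 (d - 1), pow_mul, ← mul_pow,
      Real.sqrt_div (sq_nonneg _),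
      Real.sqrt_sq (by positivity)]
    ring
  exact ⟨h4, by rw [h4]; positivity⟩

end Jacobian

/-! ### Functions computable on the real random access machine -/

namespace RealRAM

section Computes

variable {Ctx : Type*} {Pre : Ctx → (ℕ → ℕ) → (ℕ → ℝ) → Prop} {T S : Ctx → ℕ} {F G : Ctx → ℝ}

/-- `F` can be computed into any real register `k` in the contexts described by `Pre`, in time
`O(T)` and with the first `S` memory cells, without changing the real registers below `k`. -/
def Computes (Pre : Ctx → (ℕ → ℕ) → (ℕ → ℝ) → Prop) (T S : Ctx → ℕ) (F : Ctx → ℝ) : Prop :=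
  ∀ k, ∃ (P : Prog) (C : ℕ), ∀ c s, Pre c s.idx s.mem →
    Pre c (run P s).idx (run P s).mem ∧ (run P s).real k = F c ∧
    (∀ j < k, (run P s).real j = s.real j) ∧ (run P s).steps ≤ s.steps + C * T c ∧
    (run P s).space ≤ max s.space (S c)

theorem Computes.congr (h : Computes Pre T S F) (hFG : ∀ c, G c = F c) : Computes Pre T S G := by
  rwa [show G = F from funext hFG]

theorem Computes.const (hT : ∀ c, 1 ≤ T c) (q : ℚ) : Computes Pre T S fun _ => (q : ℝ) := by
  intro k
  refine ⟨.const k q, 1, fun c s h => ⟨h, by simp [run, State.setReal], fun j hj => ?_, ?_, ?_⟩⟩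
  · simp [run, State.setReal, hj.ne]
  · simpa [run, State.setReal] using hT c
  · simp [run, State.setReal]

/-- Registers act as a stack: F goes to k and G to k+1, and computing G leaves k intact. T ≥ 1
absorbs the extra step. -/
theorem Computes.binary (hT : ∀ c, 1 ≤ T c) (hF : Computes Pre T S F) (hG : Computes Pre T S G)
    (f : ℝ → ℝ → ℝ) (inst : ℕ → ℕ → ℕ → Prog)
    (hinst : ∀ a b c s, run (inst a b c) s = s.setReal a (f (s.real b) (s.real c))) :
    Computes Pre T S fun c => f (F c) (G c) := by
  intro k
  obtain ⟨P, C, hP⟩ := hF k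
  obtain ⟨Q, D, hQ⟩ := hG (k + 1)
  refine ⟨.seq P (.seq Q (inst k k (k + 1))), C + D + 1, fun c s h => ?_⟩
  obtain ⟨p1, p2, p3, p4, p5⟩ := hP c s h
  obtain ⟨q1, q2, q3, q4, q5⟩ := hQ c _ p1
  simp only [run, hinst, State.setReal]
  refine ⟨q1, ?_, fun j hj => ?_, ?_, ?_⟩
  · rw [Function.update_self, q2, q3 k (by omega), p2]
  · rw [Function.update_of_ne hj.ne, q3 j (by omega), p3 j hj]
  · have := hT c
    have : (C + D + 1) * T c = C * T c + D * T c + T c := by ring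
    omega
  · exact q5.trans (max_le p5 (le_max_right _ _))

theorem Computes.add (hT : ∀ c, 1 ≤ T c) (hF : Computes Pre T S F) (hG : Computes Pre T S G) :
    Computes Pre T S fun c => F c + G c :=
  hF.binary hT hG (· + ·) .add fun _ _ _ _ => rfl

theorem Computes.sub (hT : ∀ c, 1 ≤ T c) (hF : Computes Pre T S F) (hG : Computes Pre T S G) :
    Computes Pre T S fun c => F c - G c :=
  hF.binary hT hG (· - ·) .sub fun _ _ _ _ => rfl

theorem Computes.mul (hT : ∀ c, 1 ≤ T c) (hF : Computes Pre T S F) (hG : Computes Pre T S G) :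
    Computes Pre T S fun c => F c * G c :=
  hF.binary hT hG (· * ·) .mul fun _ _ _ _ => rfl

theorem Computes.div (hT : ∀ c, 1 ≤ T c) (hF : Computes Pre T S F) (hG : Computes Pre T S G) :
    Computes Pre T S fun c => F c / G c :=
  hF.binary hT hG (· / ·) .div fun _ _ _ _ => rfl

theorem Computes.sqrt (hT : ∀ c, 1 ≤ T c) (hF : Computes Pre T S F) :
    Computes Pre T S fun c => √(F c) := by
  intro k
  obtain ⟨P, C, hP⟩ := hF k
  refine ⟨.seq P (.sqrt k k), C + 1, fun c s h => ?_⟩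
  obtain ⟨p1, p2, p3, p4, p5⟩ := hP c s h
  simp only [run, State.setReal]
  refine ⟨p1, ?_, fun j hj => ?_, ?_, p5⟩
  · rw [Function.update_self, p2]
  · rw [Function.update_of_ne hj.ne, p3 j hj]
  · have := hT c
    have : (C + 1) * T c = C * T c + T c := by ring
    omega

theorem Computes.pow (hT : ∀ c, 1 ≤ T c) (hF : Computes Pre T S F) (m : ℕ) :
    Computes Pre T S fun c => F c ^ m := by
  induction m with
  | zero => exact (Computes.const hT 1).congr fun c => by simp
  | succ m ih => exact (ih.mul hT hF).congr fun c => pow_succ _ _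

theorem Computes.finsetSum (hT : ∀ c, 1 ≤ T c) {ι : Type*} (s : Finset ι) (f : ι → Ctx → ℝ)
    (hf : ∀ i, Computes Pre T S (f i)) : Computes Pre T S fun c => ∑ i ∈ s, f i c := by
  classical
  induction s using Finset.induction_on with
  | empty => exact (Computes.const hT 0).congr fun c => by simp
  | insert i s hi ih => exact ((hf i).add hT ih).congr fun c => Finset.sum_insert hi

theorem Computes.finsetProd (hT : ∀ c, 1 ≤ T c) {ι : Type*} (s : Finset ι) (f : ι → Ctx → ℝ)
    (hf : ∀ i, Computes Pre T S (f i)) : Computes Pre T S fun c => ∏ i ∈ s, f i c := by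
  classical
  induction s using Finset.induction_on with
  | empty => exact (Computes.const hT 1).congr fun c => by simp
  | insert i s hi ih => exact ((hf i).mul hT ih).congr fun c => Finset.prod_insert hi

/-- In the Leibniz expansion the m! terms affect only the constant, since m is fixed. -/
theorem Computes.det (hT : ∀ c, 1 ≤ T c) {m : ℕ} (M : Ctx → Matrix (Fin m) (Fin m) ℝ)
    (hM : ∀ a b, Computes Pre T S fun c => M c a b) : Computes Pre T S fun c => (M c).det := by
  refine Computes.congr (Computes.finsetSum hT Finset.univ
    (fun (σ : Equiv.Perm (Fin m)) c => (((Equiv.Perm.sign σ : ℤ) : ℚ) : ℝ) * ∏ i, M c (σ i) i)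
    fun σ => (Computes.const hT _).mul hT (Computes.finsetProd hT _ _ fun i => hM _ _)) fun c => ?_
  rw [Matrix.det_apply']
  simp

/-- The index register p₂ is scratch, so `Pre` must not depend on it. -/
theorem Computes.loadAt (hT : ∀ c, 1 ≤ T c) (a : ℕ)
    (hidx : ∀ c idx mem v, Pre c idx mem → Pre c (Function.update idx 2 v) mem)
    (hF : ∀ c idx mem, Pre c idx mem → mem a = F c ∧ a + 1 ≤ S c) : Computes Pre T S F := by
  intro k
  refine ⟨.seq (.idxConst 2 a) (.load k 2), 2, fun c s h => ?_⟩
  obtain ⟨h1, h2⟩ := hF c _ _ h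
  simp only [run, State.setIdx, State.setReal, State.touch, Function.update_self]
  refine ⟨hidx c _ _ _ h, h1, fun j hj => by rw [Function.update_of_ne hj.ne], ?_,
    max_le_max le_rfl h2⟩
  have := hT c
  omega

theorem Computes.loadOffset (hT : ∀ c, 1 ≤ T c) (o : ℕ)
    (hidx : ∀ c idx mem v, Pre c idx mem → Pre c (Function.update idx 2 v) mem)
    (hF : ∀ c idx mem, Pre c idx mem → mem (idx 1 + o) = F c ∧ idx 1 + o + 1 ≤ S c) :
    Computes Pre T S F := by
  intro k
  refine ⟨.seq (.idxConst 2 o) (.seq (.idxAdd 2 1 2) (.load k 2)), 3, fun c s h => ?_⟩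
  obtain ⟨h1, h2⟩ := hF c _ _ h
  simp only [run, State.setIdx, State.setReal, State.touch, Function.update_self,
    Function.update_idem, Function.update_of_ne (show (1 : ℕ) ≠ 2 by norm_num)]
  refine ⟨hidx c _ _ _ h, h1, fun j hj => by rw [Function.update_of_ne hj.ne], ?_,
    max_le_max le_rfl h2⟩
  have := hT c
  omega

end Computes

end RealRAM

/-! ### The Jacobian in linear time -/

section LinearTime

open RealRAM

variable {d : ℕ}

/-- The data of a polygon with a centre. -/
structure PolygonInput (d : ℕ) : Type where
  n : ℕ
  one_le : 1 ≤ n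
  r : Fin n → ℝ
  ϱ : Fin n → ℝ
  w : Vec d
  y : Fin n → Vec d

/-- The number of memory cells occupied by the input. -/
def PolygonInput.size (I : PolygonInput d) : ℕ := d + I.n * (d + 2)

/-- The registers and the memory hold the input. -/
structure InputPre (I : PolygonInput d) (idx : ℕ → ℕ) (mem : ℕ → ℝ) : Prop where
  size : idx 0 = I.n
  mem_w : ∀ k : Fin d, mem k = I.w k
  mem_r : ∀ i : Fin I.n, mem (d + i * (d + 2)) = I.r i
  mem_ϱ : ∀ i : Fin I.n, mem (d + i * (d + 2) + 1) = I.ϱ i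
  mem_y : ∀ (i : Fin I.n) (k : Fin d), mem (d + i * (d + 2) + 2 + k) = I.y i k

/-- An input with a distinguished edge. -/
abbrev PolygonEdge (d : ℕ) : Type := (I : PolygonInput d) × Fin I.n

/-- The memory holds the input, and the index register `p₁` points to the record of an edge. -/
def EdgePre (c : PolygonEdge d) (idx : ℕ → ℕ) (mem : ℕ → ℝ) : Prop :=
  InputPre c.1 idx mem ∧ idx 1 = d + c.2 * (d + 2)

/-- Functions of the whole input that are computable in linear time. -/
abbrev LinearTime (F : PolygonInput d → ℝ) : Prop :=
  Computes InputPre PolygonInput.n PolygonInput.size F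

/-- Functions of one edge and the centre that are computable in constant time. -/
abbrev ConstantTime (F : PolygonEdge d → ℝ) : Prop :=
  Computes EdgePre (fun _ => 1) (fun c => c.1.size) F

theorem InputPre.update {I : PolygonInput d} {idx : ℕ → ℕ} {mem : ℕ → ℝ}
    (h : InputPre I idx mem) {j : ℕ} (hj : j ≠ 0) (v : ℕ) :
    InputPre I (Function.update idx j v) mem :=
  ⟨by rw [Function.update_of_ne hj.symm, h.size], h.mem_w, h.mem_r, h.mem_ϱ, h.mem_y⟩

theorem EdgePre.update_two (c : PolygonEdge d) (idx : ℕ → ℕ) (mem : ℕ → ℝ) (v : ℕ)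
    (h : EdgePre c idx mem) : EdgePre c (Function.update idx 2 v) mem :=
  ⟨h.1.update two_ne_zero v, by rw [Function.update_of_ne (by norm_num), h.2]⟩

theorem edge_record_le (c : PolygonEdge d) : d + c.2 * (d + 2) + (d + 2) ≤ c.1.size := by
  have h : (c.2 + 1 : ℕ) * (d + 2) ≤ c.1.n * (d + 2) := Nat.mul_le_mul_right _ c.2.2
  rw [add_mul, one_mul] at h
  unfold PolygonInput.size
  omega

theorem linearTime_w (k : Fin d) : LinearTime fun I : PolygonInput d => I.w k :=
  Computes.loadAt PolygonInput.one_le k (fun _ _ _ v h => h.update two_ne_zero v) fun I _ _ h =>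
    ⟨h.mem_w k, by have := k.2; unfold PolygonInput.size; omega⟩

theorem constantTime_w (k : Fin d) : ConstantTime fun c : PolygonEdge d => c.1.w k :=
  Computes.loadAt (fun _ => le_rfl) k EdgePre.update_two fun c _ _ h =>
    ⟨h.1.mem_w k, by have := k.2; unfold PolygonInput.size; omega⟩

theorem constantTime_r : ConstantTime fun c : PolygonEdge d => c.1.r c.2 :=
  Computes.loadOffset (fun _ => le_rfl) 0 EdgePre.update_two fun c _ _ h =>
    ⟨by rw [h.2, add_zero, h.1.mem_r], by have := edge_record_le c; rw [h.2]; omega⟩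

theorem constantTime_ϱ : ConstantTime fun c : PolygonEdge d => c.1.ϱ c.2 :=
  Computes.loadOffset (fun _ => le_rfl) 1 EdgePre.update_two fun c _ _ h =>
    ⟨by rw [h.2, h.1.mem_ϱ], by have := edge_record_le c; rw [h.2]; omega⟩

theorem constantTime_y (k : Fin d) : ConstantTime fun c : PolygonEdge d => c.1.y c.2 k :=
  Computes.loadOffset (fun _ => le_rfl) (2 + k) EdgePre.update_two fun c _ _ h =>
    ⟨by rw [h.2, ← add_assoc, h.1.mem_y], by
      have := edge_record_le c
      have := k.2
      rw [h.2]
      omega⟩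

/-- Folding a binary operation over all edges takes linear time. -/
theorem LinearTime.fold {F : PolygonEdge d → ℝ} (hF : ConstantTime F) (q : ℚ) (f : ℝ → ℝ → ℝ)
    (inst : ℕ → ℕ → ℕ → Prog)
    (hinst : ∀ a b c s, run (inst a b c) s = s.setReal a (f (s.real b) (s.real c)))
    (G : PolygonInput d → ℕ → ℝ) (hG0 : ∀ I, G I 0 = q)
    (hG : ∀ I (i : Fin I.n), G I (i + 1) = f (G I i) (F ⟨I, i⟩)) :
    LinearTime fun I => G I I.n := by
  intro k
  obtain ⟨P, C, hP⟩ := hF (k + 1)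
  -- Register k accumulates, k+1 receives the value at the current edge, and p₁ advances by the
  -- record length d+2, held in p₃.
  set body : Prog := .seq P (.seq (inst k k (k + 1)) (.seq (.idxConst 3 (d + 2)) (.idxAdd 1 1 3)))
    with hbody
  refine ⟨.seq (.const k q) (.seq (.idxConst 1 d) (.loop 0 body)), C + 7, fun I s h => ?_⟩
  set s0 := (run (.idxConst 1 d) (run (.const k q) s)).tick with hs0
  -- The 3 counts the two initialisations and the loop entry. Each round costs C for P and 4 more:
  -- the iteration itself, the accumulation and two index instructions.
  have hinv : ∀ m ≤ I.n, ∀ t, t = (fun t => run body t.tick)^[m] s0 →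
      InputPre I t.idx t.mem ∧ t.idx 1 = d + m * (d + 2) ∧
      t.real k = G I m ∧ (∀ j < k, t.real j = s.real j) ∧
      t.steps ≤ s.steps + 3 + m * (C + 4) ∧ t.space ≤ max s.space I.size := by
    intro m
    induction m with
    | zero =>
      rintro - t rfl
      simp only [hs0, Function.iterate_zero, id, run, State.setReal, State.setIdx, State.tick]
      refine ⟨h.update one_ne_zero d, by simp, by simp [hG0], fun j hj => ?_, by omega,
        le_max_left _ _⟩
      rw [Function.update_of_ne hj.ne]
    | succ m ih =>
      rintro hm t rfl
      obtain ⟨h1, h2, h3, h4, h5, h6⟩ := ih (by omega) _ rfl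
      rw [Function.iterate_succ_apply']
      set t := (fun t => run body t.tick)^[m] s0
      obtain ⟨p1, p2, p3, p4, p5⟩ := hP ⟨I, ⟨m, by omega⟩⟩ t.tick ⟨h1, h2⟩
      simp only [hbody, run, hinst, State.setReal, State.setIdx]
      refine ⟨(p1.1.update three_ne_zero _).update one_ne_zero _, ?_, ?_, fun j hj => ?_, ?_, ?_⟩
      · have := p1.2
        simp only at this
        simp only [Function.update_self, Function.update_of_ne (show (1 : ℕ) ≠ 3 by norm_num), this]
        ring
      · rw [Function.update_self, p2, p3 k (by omega)]
        simp only [State.tick, h3]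
        exact (hG I ⟨m, by omega⟩).symm
      · rw [Function.update_of_ne hj.ne, p3 j (by omega)]
        exact h4 j hj
      · have e1 : (m + 1) * (C + 4) = m * (C + 4) + C + 4 := by ring
        have ht : t.tick.steps = t.steps + 1 := rfl
        simp only [ht, mul_one] at p4
        omega
      · exact p5.trans (max_le h6 (le_max_right _ _))
  have hs0idx : (run (.idxConst 1 d) (run (.const k q) s)).idx 0 = I.n := by
    simp [run, State.setIdx, State.setReal, h.size]
  have hrun : run (.seq (.const k q) (.seq (.idxConst 1 d) (.loop 0 body))) s =
      (fun t => run body t.tick)^[I.n] s0 := by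
    rw [← hs0idx]
    rfl
  obtain ⟨h1, -, h3, h4, h5, h6⟩ := hinv I.n le_rfl _ hrun
  refine ⟨h1, h3, h4, h5.trans ?_, h6⟩
  have := I.one_le
  have : (C + 7) * I.n = I.n * (C + 4) + 3 * I.n := by ring
  omega

theorem LinearTime.sumEdges {F : PolygonEdge d → ℝ} (hF : ConstantTime F) :
    LinearTime fun I => ∑ i, F ⟨I, i⟩ := by
  refine (LinearTime.fold hF 0 (· + ·) .add (fun _ _ _ _ => rfl)
    -- The value 0 is never used for m ≤ n; it only makes partial sums total in m.
    (fun I m => ∑ i ∈ Finset.range m, if h : i < I.n then F ⟨I, ⟨i, h⟩⟩ else 0)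
    (fun I => by simp) fun I i => ?_).congr fun I => ?_
  · rw [Finset.sum_range_succ, dif_pos i.2]
  · rw [← Fin.sum_univ_eq_sum_range (fun i => if h : i < I.n then F ⟨I, ⟨i, h⟩⟩ else 0)]
    exact Finset.sum_congr rfl fun i _ => by rw [dif_pos i.2]

theorem LinearTime.prodEdges {F : PolygonEdge d → ℝ} (hF : ConstantTime F) :
    LinearTime fun I => ∏ i, F ⟨I, i⟩ := by
  refine (LinearTime.fold hF 1 (· * ·) .mul (fun _ _ _ _ => rfl)
    (fun I m => ∏ i ∈ Finset.range m, if h : i < I.n then F ⟨I, ⟨i, h⟩⟩ else 0)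
    (fun I => by simp) fun I i => ?_).congr fun I => ?_
  · rw [Finset.prod_range_succ, dif_pos i.2]
  · rw [← Fin.prod_univ_eq_prod_range (fun i => if h : i < I.n then F ⟨I, ⟨i, h⟩⟩ else 0)]
    exact Finset.prod_congr rfl fun i _ => by rw [dif_pos i.2]

theorem linearTime_one_sub_norm_sq : LinearTime fun I : PolygonInput d => 1 - ‖I.w‖ ^ 2 := by
  have hT := PolygonInput.one_le (d := d)
  refine ((Computes.const hT 1).sub hT (Computes.finsetSum hT Finset.univ (fun k I => I.w k ^ 2)
    fun k => (linearTime_w k).pow hT 2)).congr fun I => ?_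
  rw [EuclideanSpace.norm_sq_eq]
  simp

theorem constantTime_factor :
    ConstantTime fun c : PolygonEdge d => (1 - ‖c.1.w‖ ^ 2) / ‖c.1.w + c.1.y c.2‖ ^ 2 := by
  have hT : ∀ c : PolygonEdge d, 1 ≤ (fun _ : PolygonEdge d => 1) c := fun _ => le_rfl
  refine (((Computes.const hT 1).sub hT (Computes.finsetSum hT Finset.univ
    (fun k c => c.1.w k ^ 2) fun k => (constantTime_w k).pow hT 2)).div hT
    (Computes.finsetSum hT Finset.univ (fun k c => (c.1.w k + c.1.y c.2 k) ^ 2) fun k =>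
      ((constantTime_w k).add hT (constantTime_y k)).pow hT 2)).congr fun c => ?_
  rw [EuclideanSpace.norm_sq_eq, EuclideanSpace.norm_sq_eq]
  simp

/-- Each matrix entry is a sum over edges. Every occurrence of an entry reruns its loop, but the
number of occurrences depends only on d. -/
theorem linearTime_det_projSum {c : PolygonEdge d → ℝ} (hc : ConstantTime c) :
    LinearTime fun I => (projSum (fun i => c ⟨I, i⟩) I.y).det := by
  have hT : ∀ c : PolygonEdge d, 1 ≤ (fun _ : PolygonEdge d => 1) c := fun _ => le_rfl
  refine Computes.det PolygonInput.one_le (fun I : PolygonInput d =>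
    projSum (fun i => c ⟨I, i⟩) I.y) fun a b => ?_
  refine (LinearTime.sumEdges (hc.mul hT ((Computes.const hT (if a = b then 1 else 0)).sub hT
    ((constantTime_y a).mul hT (constantTime_y b))))).congr fun I => ?_
  rw [projSum_apply]
  exact Finset.sum_congr rfl fun i _ => by split_ifs <;> simp

theorem linearTime_jacobian : LinearTime fun I : PolygonInput d =>
    (2 / (1 - ‖I.w‖ ^ 2)) ^ d *
      ((projSum I.r I.y).det / √(projSum (fun i => I.r i ^ 2 / I.ϱ i ^ 2) I.y).det) *
      (∏ i, (1 - ‖I.w‖ ^ 2) / ‖I.w + I.y i‖ ^ 2) ^ (d - 1) := by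
  have hT := PolygonInput.one_le (d := d)
  have hT' : ∀ c : PolygonEdge d, 1 ≤ (fun _ : PolygonEdge d => 1) c := fun _ => le_rfl
  have h1 := (((Computes.const hT 2).div hT linearTime_one_sub_norm_sq).pow hT d).mul hT
    ((linearTime_det_projSum constantTime_r).div hT ((linearTime_det_projSum
      ((constantTime_r.pow hT' 2).div hT' (constantTime_ϱ.pow hT' 2))).sqrt hT))
  exact (h1.mul hT ((LinearTime.prodEdges constantTime_factor).pow hT (d - 1))).congr
    fun I => by simp

end LinearTime

end ConformalPolygon

end

theorem theorem3p1 (d : ℕ) (hd : 2 ≤ d) :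
    -- the formula for the Jacobian, and the diffeomorphism
    (∀ (n : ℕ), 3 ≤ n → ∀ (r ϱ : Fin n → ℝ), (∀ i, 0 < r i) → ∀ (hϱ : ∀ i, 0 < ϱ i),
      (∀ j, r j < (1 / 2) * ∑ i, r i) →
        (∀ w ∈ ConformalPolygon.unitBall d, ∀ y ∈ ConformalPolygon.PolX d r,
          ConformalPolygon.Jop r ϱ hϱ w y =
            (2 / (1 - ‖w‖ ^ 2)) ^ d *
              ((ConformalPolygon.projSum r y).det /
                Real.sqrt (ConformalPolygon.projSum (fun i => r i ^ 2 / ϱ i ^ 2) y).det) *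
              (∏ i, (1 - ‖w‖ ^ 2) / ‖w + y i‖ ^ 2) ^ (d - 1) ∧
          ConformalPolygon.Jop r ϱ hϱ w y ≠ 0) ∧
        ConformalPolygon.IsSmoothSubmanifold
          (ConformalPolygon.unitBall d ×ˢ ConformalPolygon.PolX d r) (n * (d - 1)) ∧
        ConformalPolygon.IsSmoothSubmanifold (ConformalPolygon.ArmX d n) (n * (d - 1)) ∧
        (∀ x ∈ ConformalPolygon.ArmX d n,
          ∃! w, ConformalPolygon.IsConformalBarycenter r x w) ∧
        ConformalPolygon.IsDiffeomorphismWithInverse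
          ConformalPolygon.opening (ConformalPolygon.closureMap r)
          (ConformalPolygon.unitBall d ×ˢ ConformalPolygon.PolX d r)
          (ConformalPolygon.ArmX d n)) ∧
    -- linear time and memory, by one program that depends only on `d`
    (∃ (P : ConformalPolygon.RealRAM.Prog) (C : ℕ), ∀ (n : ℕ), 3 ≤ n →
      ∀ (r ϱ : Fin n → ℝ), (∀ i, 0 < r i) → ∀ (hϱ : ∀ i, 0 < ϱ i),
      (∀ j, r j < (1 / 2) * ∑ i, r i) →
        ∀ w ∈ ConformalPolygon.unitBall d, ∀ y ∈ ConformalPolygon.PolX d r,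
          ∀ s : ConformalPolygon.RealRAM.State, ConformalPolygon.HoldsInput r ϱ w y s →
            (ConformalPolygon.RealRAM.run P s).real 0 = ConformalPolygon.Jop r ϱ hϱ w y ∧
            (ConformalPolygon.RealRAM.run P s).steps ≤ C * n ∧
            (ConformalPolygon.RealRAM.run P s).space ≤ C * n) := by
  refine ⟨fun n hn r ϱ hr hϱ hr2 => ⟨fun w hw y hy =>
    ConformalPolygon.Jop_eq hd hn hr hϱ hw hy,
    ConformalPolygon.isSmoothSubmanifold_ball_PolX hd hn hr,
    ConformalPolygon.isSmoothSubmanifold_ArmX hd,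
    fun x hx => ConformalPolygon.existsUnique_isConformalBarycenter hn hr hr2 hx,
    ConformalPolygon.isDiffeomorphism_opening hn hr hr2⟩, ?_⟩
  obtain ⟨P, C, hP⟩ := ConformalPolygon.linearTime_jacobian (d := d) 0
  -- C bounds the time. The summand 2d+2 bounds the space: the input occupies d + n(d+2) ≤ (2d+2)n
  -- cells, and no others are accessed.
  refine ⟨P, C + (2 * d + 2), fun n hn r ϱ hr hϱ _ w hw y hy s hs => ?_⟩
  obtain ⟨-, h1, -, h2, h3⟩ := hP ⟨n, by omega, r, ϱ, w, y⟩ s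
    ⟨hs.size, hs.mem_w, hs.mem_r, hs.mem_ϱ, hs.mem_y⟩
  rw [hs.steps, zero_add] at h2
  rw [hs.space, ConformalPolygon.PolygonInput.size] at h3
  refine ⟨by rw [h1, (ConformalPolygon.Jop_eq hd hn hr hϱ hw hy).1], h2.trans ?_, h3.trans ?_⟩
  · exact Nat.mul_le_mul_right n (Nat.le_add_right C (2 * d + 2))
  · refine max_le (Nat.zero_le _) ?_
    nlinarith
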